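/- **Setting.** Let $I$ and $J$ be finite sets. Call a function $\mathbb R\to\mathbb R$ *admissible* if it is continuous, strictly decreasing and onto $\mathbb R$. A *two-sided market* $M=(I,J,\{u_i^j\},\{q_i^j\})$ consists of admissible functions $u_i^j,q_i^j$ ($i\in I$, $j\in J$): if $i$ and $j$ are matched and the amount $x\in\mathbb R$ of money goes from $i$ to $j$, then $i$ gets utility $u_i^j(x)$ and $j$ gets utility $q_i^j(-x)$. A *competitive equilibrium* of $M$ is a pair $W=(\mathbf u,\mathbf p)\in\mathbb R_{\ge0}^I\times\mathbb R_{\ge 0}^J$ of payoff vectors for which there are a matching $\mu$ between $I$ and $J$ and transfers $t_{ij}\in\mathbb R$ for all pairs (a supporting matching with supporting transfers) with $\mathbf u_i\ge u_i^j(t_{ij})$ and $\mathbf p^j\ge q_i^j(-t_{ij})$ for all $i,j$, with equality in both if $i,j$ are matched, and with payoff $0$ for every unmatched agent. A *buyer/good market* $M'=(I,J,\{u'^j_i\})$ consists of admissible functions $u'^j_i$; a competitive equilibrium of it is a pair $(\mathbf u,\mathbf p)\ge 0$ of payoffs of buyers and prices of goods for which there is a (supporting) matching such that $\mathbf u_i\ge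 u'^j_i(\mathbf p^j)$ for all $i,j$, with equality if $i,j$ are matched, and unmatched buyers have payoff $0$ and unmatched goods price $0$. Order equilibria by $W\le W'$ iff $\mathbf p\le\mathbf p'$ in every component; the *lowest* and the *highest* equilibrium are the least and the greatest one. **Statement.** For a two-sided market $M$ put $u'^j_i(y)=u_i^j\bigl(-(q_i^j)^{-1}(y)\bigr)$. These functions are admissible; let $M'=(I,J,\{u'^j_i\})$, and let $p_i^j$ be the inverse of $u'^j_i$. 1. $M$ and $M'$ have the same competitive equilibria $(\mathbf u,\mathbf p)$ (with the payoffs of type-$J$ agents as the prices of goods), with the same supporting matchings. In every equilibrium of $M$, the transfer from $i$ to its partner $j$ is $-(q_i^j)^{-1}(\mathbf p^j)$. 2. Consequently the results on buyer/good markets hold for $M$: * (Lattice.) The equilibria of $M$ form a complete lattice; $W\le W'$ iff $\mathbf u\ge\mathbf u'$; $W\wedge W'=(\max(\mathbf u,\mathbf u'),\min(\mathbf p,\mathbf p'))$ and $W\vee W'=(\min(\mathbf u,\mathbf u'),\max(\mathbf p,\mathbf p'))$ componentwise. If $\mu,\mu'$ support $W,W'$, then $W\wedge W'$ is supported by the matching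 that uses $\mu(i)$ if $\mathbf u_i\ge\mathbf u'_i$ and $\mu'(i)$ otherwise, and $W\vee W'$ by the one that uses $\mu(i)$ if $\mathbf u_i<\mathbf u'_i$ and $\mu'(i)$ otherwise. In particular there are a unique lowest equilibrium $\underline W$ and a unique highest equilibrium $\overline W$. * (Inductive characterization.) For $i\in I$ let $\overline W_{-i}$ be the highest equilibrium of the market without $i$, with $J$-payoffs $\mathbf h$. Then $u_i(\underline W)=\max(\{u'^j_i(\mathbf h^j):j\in J\}\cup\{0\})$, and $p^j(\underline W)\le \mathbf h^j$ for all $j$, with equality if $i$ is matched to $j$ in a supporting matching of $\underline W$. For $j\in J$ let $\underline W^{-j}$ be the lowest equilibrium of the market without $j$, with $I$-payoffs $\mathbf l$. Then $p^j(\overline W)=\max(\{p_i^j(\mathbf l_i):i\in I\}\cup\{0\})$, and $u_i(\overline W)\le \mathbf l_i$ for all $i$, with equality if $i$ is matched to $j$ in a supporting matching of $\overline W$. * (Tightness.) Write $u_i(\mathbf p)=\max(\{u'^j_i(\mathbf p^j):j\in J\}\cup\{0\})$ and $p^j(\mathbf u)=\max(\{p_i^j(\mathbf u_i):i\in I\}\cup\{0\})$.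 An equilibrium $(\mathbf u,\mathbf p)$ is the lowest iff for every nonempty $T\subseteq J$ with $\mathbf p^j>0$ on $T$ at least $|T|+1$ agents $i\in I$ satisfy $p_i^j(\mathbf u_i)=p^j(\mathbf u)$ for some $j\in T$; it is the highest iff for every nonempty $S\subseteq I$ with $\mathbf u_i>0$ on $S$ at least $|S|+1$ agents $j\in J$ satisfy $u'^j_i(\mathbf p^j)=u_i(\mathbf p)$ for some $i\in S$. * (Critical alternating paths.) Call $(i,j)$ tight at $W=(\mathbf u,\mathbf p)$ if $\mathbf u_i=u'^j_i(\mathbf p^j)$, and let $\mu$ support $W$. Consider paths of tight edges, every other edge of which belongs to $\mu$, and which have length $0$ or start with an edge of $\mu$. Then $W$ is the highest equilibrium iff from every $j\in J$ such a path leads to an $i\in I$ with $\mathbf u_i=0$ or to an unmatched element of $J$; $W$ is the lowest iff from every $i\in I$ such a path leads to a $j\in J$ with $\mathbf p^j=0$ or to an unmatched element of $I$. 3. (Group strategyproofness.) Fix $\{q_i^j\}$. Consider any mechanism that, from reported admissible $\{u_i^j\}$, outputs a matching and transfers supporting the lowest competitive equilibrium of the reported market. It is group strategyproof for type $I$: no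 nonempty coalition of agents of type $I$ can misreport their functions so that each member gets a strictly higher true payoff than under truthful reports. Symmetrically, for fixed $\{u_i^j\}$, any mechanism that, from reported $\{q_i^j\}$, outputs a matching and transfers supporting the highest equilibrium (which is the lowest one for the agents of type $J$) is group strategyproof for type $J$. 4. If the roles of $I$ and $J$ are exchanged, the lowest equilibrium becomes the highest one and vice versa. -/

import Mathlib

/-- An admissible utility function of the money paid: continuous, strictly decreasing, and
with range all of `ℝ` (so it is a bijection of `ℝ`). -/
structure IsUtility (f : ℝ → ℝ) : Prop where
  continuous : Continuous f
  strictAnti : StrictAnti f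
  surjective : Function.Surjective f

/-- One admissible utility function for every pair `(i, j)`. -/
structure UtilityProfile (I J : Type*) where
  util : I → J → ℝ → ℝ
  isUtility : ∀ i j, IsUtility (util i j)

instance (I J : Type*) : CoeFun (UtilityProfile I J) (fun _ => I → J → ℝ → ℝ) :=
  ⟨UtilityProfile.util⟩

/-- The inverse of the bijection `U i j`. -/
noncomputable def UtilityProfile.inv {I J : Type*} (U : UtilityProfile I J) (i : I) (j : J) :
    ℝ → ℝ :=
  Function.invFun (U i j)

/-- A pair of vectors: the payoffs `u` of the side `I`, and for the side `J` the vector `p` of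
prices (when `J` consists of goods) or of payoffs (when `J` consists of agents). -/
@[ext]
structure EqPoint (I J : Type*) where
  u : I → ℝ
  p : J → ℝ

def EqPoint.swap {I J : Type*} (W : EqPoint I J) : EqPoint J I := ⟨W.p, W.u⟩

/-- `W` is the lowest element of `E`: it has the lowest vector `p`. -/
def IsLowestIn {I J : Type*} (E : Set (EqPoint I J)) (W : EqPoint I J) : Prop :=
  W ∈ E ∧ ∀ W' ∈ E, W.p ≤ W'.p

/-- `W` is the highest element of `E`: it has the highest vector `p`. -/
def IsHighestIn {I J : Type*} (E : Set (EqPoint I J)) (W : EqPoint I J) : Prop :=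
  W ∈ E ∧ ∀ W' ∈ E, W'.p ≤ W.p

/-! ### Markets with buyers and goods -/

/-- A market of unit-demand buyers `I` and goods `J`; `u i j x` is the utility of buyer `i` for
good `j` at price `x`. -/
structure GoodsMarket (I J : Type*) where
  u : UtilityProfile I J

namespace GoodsMarket

variable {I J : Type*}

/-- `μ` is a supporting matching for the payoffs `W.u` and the prices `W.p`. -/
structure Supports (M : GoodsMarket I J) (W : EqPoint I J) (μ : I ≃. J) : Prop where
  matched : ∀ i j, μ i = some j → W.u i = M.u i j (W.p j)
  preferred : ∀ i j, μ i ≠ some j → W.u i ≥ M.u i j (W.p j)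
  unmatched_buyer : ∀ i, μ i = none → W.u i = 0
  unmatched_good : ∀ j, μ.symm j = none → W.p j = 0
  payoff_nonneg : ∀ i, 0 ≤ W.u i
  price_nonneg : ∀ j, 0 ≤ W.p j

/-- The set of competitive equilibria. -/
def equilibria (M : GoodsMarket I J) : Set (EqPoint I J) :=
  {W | ∃ μ : I ≃. J, M.Supports W μ}

/-- `u_i(p)`: the maximum of `0` and of the utilities `u i j (p j)` over all goods `j`. -/
noncomputable def inducedPayoff (M : GoodsMarket I J) (p : J → ℝ) (i : I) : ℝ :=
  sSup (insert 0 (Set.range fun j => M.u i j (p j)))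

/-- `p^j(u)`: the maximum of `0` and of the prices of `j` at which buyer `i` gets `u i`, over all
buyers `i`. -/
noncomputable def inducedPrice (M : GoodsMarket I J) (u : I → ℝ) (j : J) : ℝ :=
  sSup (insert 0 (Set.range fun i => M.u.inv i j (u i)))

/-- The goods that some buyer in `S` likes best at the prices `p`. -/
def demandOfBuyers (M : GoodsMarket I J) (S : Set I) (p : J → ℝ) : Set J :=
  {j | ∃ i ∈ S, M.u i j (p j) = M.inducedPayoff p i}

/-- The buyers who name the highest price for some good in `T` at the payoffs `u`. -/
def demandOfGoods (M : GoodsMarket I J) (T : Set J) (u : I → ℝ) : Set I :=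
  {i | ∃ j ∈ T, M.u.inv i j (u i) = M.inducedPrice u j}

/-- The edge `(i, j)` is tight at `W`. -/
def Tight (M : GoodsMarket I J) (W : EqPoint I J) (i : I) (j : J) : Prop :=
  W.u i = M.u i j (W.p j)

/-- Some tight alternating path for `W`, `μ`, of length `0` or with a matching edge first, leads
from buyer `i` to a good of price `0` or to an unmatched buyer. The path runs along the matching
from buyers to goods and along arbitrary tight edges from goods to buyers. -/
def CriticalFromBuyer (M : GoodsMarket I J) (W : EqPoint I J) (μ : I ≃. J) (i : I) : Prop :=
  ∃ k, Relation.ReflTransGen (fun a b => ∃ j, μ a = some j ∧ M.Tight W b j) i k ∧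
    (μ k = none ∨ ∃ j, μ k = some j ∧ W.p j = 0)

/-- Some tight alternating path for `W`, `μ`, of length `0` or with a matching edge first, leads
from good `j` to a buyer of payoff `0` or to an unmatched good. -/
def CriticalFromGood (M : GoodsMarket I J) (W : EqPoint I J) (μ : I ≃. J) (j : J) : Prop :=
  ∃ k, Relation.ReflTransGen (fun a b => ∃ i, μ.symm a = some i ∧ M.Tight W i b) j k ∧
    (μ.symm k = none ∨ ∃ i, μ.symm k = some i ∧ W.u i = 0)

end GoodsMarket

/-! ### Markets with agents on both sides -/

/-- A matching together with the money `transfer i j` that goes (or would go) from `i` to `j`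
in case `i` and `j` are matched; it may be negative. -/
structure Outcome (I J : Type*) where
  matching : I ≃. J
  transfer : I → J → ℝ

/-- A market with agents on both sides: when `i` and `j` are matched and `i` pays `x` to `j`, the
utility of `i` is `u i j x` and the utility of `j` is `q i j (-x)`. -/
structure AgentMarket (I J : Type*) where
  u : UtilityProfile I J
  q : UtilityProfile I J

theorem IsUtility.invFun {f : ℝ → ℝ} (hf : IsUtility f) : IsUtility (Function.invFun f) := by
  have hr : Function.RightInverse (Function.invFun f) f := Function.rightInverse_invFun hf.surjective
  have hl : Function.LeftInverse (Function.invFun f) f :=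
    Function.leftInverse_invFun hf.strictAnti.injective
  have ha : StrictAnti (Function.invFun f) := fun a b hab => by
    rw [← hf.strictAnti.lt_iff_gt, hr a, hr b]
    exact hab
  refine ⟨?_, ha, hl.surjective⟩
  have hm : Monotone fun x => -Function.invFun f x := fun a b hab => neg_le_neg (ha.antitone hab)
  have hs : Function.Surjective fun x => -Function.invFun f x :=
    neg_surjective.comp hl.surjective
  exact (continuous_neg.comp (hm.continuous_of_surjective hs)).congr fun x => by simp

theorem IsUtility.comp_neg {f g : ℝ → ℝ} (hf : IsUtility f) (hg : IsUtility g) :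
    IsUtility fun y => f (-g y) where
  continuous := hf.continuous.comp hg.continuous.neg
  strictAnti := fun _ _ h => hf.strictAnti (neg_lt_neg (hg.strictAnti h))
  surjective := hf.surjective.comp (neg_surjective.comp hg.surjective)

namespace AgentMarket

variable {I J : Type*}

/-- The matching and the transfers of `o` support the payoffs `W`: at the transfers attached to
the pairs, every agent on either side is matched to a most preferred partner, or is unmatched
with payoff `0` and prefers no partner to that. -/
structure SupportedBy (M : AgentMarket I J) (W : EqPoint I J) (o : Outcome I J) : Prop where
  matched_left : ∀ i j, o.matching i = some j → W.u i = M.u i j (o.transfer i j)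
  matched_right : ∀ i j, o.matching i = some j → W.p j = M.q i j (-o.transfer i j)
  preferred_left : ∀ i j, o.matching i ≠ some j → W.u i ≥ M.u i j (o.transfer i j)
  preferred_right : ∀ i j, o.matching i ≠ some j → W.p j ≥ M.q i j (-o.transfer i j)
  unmatched_left : ∀ i, o.matching i = none → W.u i = 0
  unmatched_right : ∀ j, o.matching.symm j = none → W.p j = 0
  nonneg_left : ∀ i, 0 ≤ W.u i
  nonneg_right : ∀ j, 0 ≤ W.p j

/-- The set of (payoff pairs of) competitive equilibria. -/
def equilibria (M : AgentMarket I J) : Set (EqPoint I J) :=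
  {W | ∃ o : Outcome I J, M.SupportedBy W o}

def IsLowest (M : AgentMarket I J) (W : EqPoint I J) : Prop := IsLowestIn M.equilibria W

def IsHighest (M : AgentMarket I J) (W : EqPoint I J) : Prop := IsHighestIn M.equilibria W

/-- The buyer/good market with utilities `u' i j = u i j (-(q i j)⁻¹ ·)`. -/
noncomputable def reduce (M : AgentMarket I J) : GoodsMarket I J where
  u :=
    { util := fun i j y => M.u i j (-M.q.inv i j y)
      isUtility := fun i j => (M.u.isUtility i j).comp_neg (M.q.isUtility i j).invFun }

/-- The same market with the roles of the two sides exchanged. -/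
def swap (M : AgentMarket I J) : AgentMarket J I where
  u := ⟨fun j i => M.q i j, fun j i => M.q.isUtility i j⟩
  q := ⟨fun j i => M.u i j, fun j i => M.u.isUtility i j⟩

/-- The market without the agent `i` of type `I`. -/
def removeLeft (M : AgentMarket I J) (i : I) : AgentMarket {k : I // k ≠ i} J where
  u := ⟨fun k j => M.u k j, fun k j => M.u.isUtility k j⟩
  q := ⟨fun k j => M.q k j, fun k j => M.q.isUtility k j⟩

/-- The market without the agent `j` of type `J`. -/
def removeRight (M : AgentMarket I J) (j : J) : AgentMarket I {k : J // k ≠ j} where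
  u := ⟨fun i k => M.u i k, fun i k => M.u.isUtility i k⟩
  q := ⟨fun i k => M.q i k, fun i k => M.q.isUtility i k⟩

end AgentMarket

/-! ### Mechanisms -/

section Mechanisms

variable {I J : Type*}

/-- The payoff of `i` from the outcome `o` when the utilities of the side `I` are `u`. -/
noncomputable def leftPayoff (u : UtilityProfile I J) (o : Outcome I J) (i : I) : ℝ :=
  (o.matching i).elim 0 fun j => u i j (o.transfer i j)

/-- The payoff of `j` from the outcome `o` when the utilities of the side `J` are `q`. -/
noncomputable def rightPayoff (q : UtilityProfile I J) (o : Outcome I J) (j : J) : ℝ :=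
  (o.matching.symm j).elim 0 fun i => q i j (-o.transfer i j)

/-- With `q` fixed, the agents of type `I` report utilities `u`, and `f` outputs a matching and
transfers that support the lowest competitive equilibrium of the reported market. -/
def SelectsLowest (q : UtilityProfile I J) (f : UtilityProfile I J → Outcome I J) : Prop :=
  ∀ u, ∃ W, (AgentMarket.mk u q).IsLowest W ∧ (AgentMarket.mk u q).SupportedBy W (f u)

/-- With `u` fixed, the agents of type `J` report utilities `q`, and `f` outputs a matching and
transfers that support the highest competitive equilibrium of the reported market. -/
def SelectsHighest (u : UtilityProfile I J) (f : UtilityProfile I J → Outcome I J) : Prop :=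
  ∀ q, ∃ W, (AgentMarket.mk u q).IsHighest W ∧ (AgentMarket.mk u q).SupportedBy W (f q)

/-- No nonempty coalition `S` of agents of type `I` with true utilities in `u` can misreport
(`u'`) so that all its members get strictly higher true payoffs. -/
def GroupStrategyproofLeft (f : UtilityProfile I J → Outcome I J) : Prop :=
  ∀ (u u' : UtilityProfile I J) (S : Set I), S.Nonempty →
    (∀ i, i ∉ S → ∀ j, u' i j = u i j) →
    ¬ ∀ i ∈ S, leftPayoff u (f u) i < leftPayoff u (f u') i

/-- The same for coalitions of agents of type `J`. -/
def GroupStrategyproofRight (f : UtilityProfile I J → Outcome I J) : Prop :=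
  ∀ (q q' : UtilityProfile I J) (S : Set J), S.Nonempty →
    (∀ j, j ∉ S → ∀ i, q' i j = q i j) →
    ¬ ∀ j ∈ S, rightPayoff q (f q) j < rightPayoff q (f q') j

end Mechanisms

/-! If `j` is to receive the payoff `p j` from `i`, the transfer must be `-(q i j)⁻¹ (p j)`.
Transfers can thus be eliminated, and only the payoff frontier `U i j` of each pair matters.
Equilibria are studied for arbitrary reservation values `r`, `a`: raising them removes agents or
forces prices up without changing the types. Exchanging the sides replaces `U` by `U.dual`, so facts
about highest equilibria give facts about lowest ones.

Decomposition: given two equilibria, the buyers better off in the first and the goods dearer in the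
second are matched to each other by both matchings (`forall_exists_left`, `forall_exists_right'` and
a count). Splicing matchings along this decomposition gives meets and joins; compactness then gives
extreme equilibria once there is some equilibrium.

Critical paths: if the goods reachable from `j` contain no critical end, their prices can be raised
together (`exists_higher`), so a highest equilibrium has critical paths everywhere. Along such a
path a new buyer can be inserted without changing prices (`exists_insert`). Induction on the
relevant buyers gives existence, and the same insertion gives the inductive characterization.

Tightness is the Hall-type form of the path criterion. It yields a blocking lemma
(`exists_blocking`): a coalition gaining over the lowest equilibrium leaves a nonmember who would
break the supposed equilibrium of the reported market. -/

/-! ### Inverse utilities and duality. -/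

namespace UtilityProfile

variable {I J : Type*} (U : UtilityProfile I J) {i : I} {j : J} {x y : ℝ}

theorem inv_apply (i : I) (j : J) (x : ℝ) : U.inv i j (U i j x) = x :=
  Function.leftInverse_invFun (U.isUtility i j).strictAnti.injective x

theorem apply_inv (i : I) (j : J) (x : ℝ) : U i j (U.inv i j x) = x :=
  Function.rightInverse_invFun (U.isUtility i j).surjective x

theorem lt_iff : U i j x < U i j y ↔ y < x := (U.isUtility i j).strictAnti.lt_iff_gt

theorem le_iff : U i j x ≤ U i j y ↔ y ≤ x := (U.isUtility i j).strictAnti.le_iff_ge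

theorem inv_le_iff : U.inv i j x ≤ y ↔ U i j y ≤ x := by
  rw [← U.le_iff (i := i) (j := j), U.apply_inv]

theorem inv_eq_iff : y = U.inv i j x ↔ x = U i j y :=
  ⟨fun h => by rw [h, U.apply_inv], fun h => by rw [h, U.inv_apply]⟩

/-- The inverse functions, as utility functions of the other side. -/
noncomputable def dual : UtilityProfile J I where
  util j i := U.inv i j
  isUtility j i := (U.isUtility i j).invFun

theorem dual_apply : U.dual j i x = U.inv i j x := rfl

theorem dual_inv_apply : U.dual.inv j i x = U i j x := by
  have h := U.dual.inv_apply j i (U i j x)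
  rwa [dual_apply, inv_apply] at h

theorem dual_dual : U.dual.dual = U := by
  cases U with
  | mk f hf =>
    have : (dual (dual ⟨f, hf⟩)).util = f := by
      funext i j x
      exact dual_inv_apply ⟨f, hf⟩
    generalize dual (dual ⟨f, hf⟩) = V at this
    cases V
    subst this
    rfl

end UtilityProfile

/-! ### Counting with partial matchings. -/

namespace PEquiv

variable {α β : Type*}

/-- A partial function that is injective where it is defined, as a partial equivalence. -/
noncomputable def ofPartialInjective (f : α → Option β)
    (hf : ∀ a a' b, f a = some b → f a' = some b → a = a') : α ≃. β where
  toFun := f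
  invFun b := open Classical in if h : ∃ a, f a = some b then some h.choose else none
  inv a b := by
    classical
    by_cases h : ∃ a, f a = some b
    · simp only [dif_pos h, Option.some_inj]
      exact ⟨fun e => e ▸ h.choose_spec, fun e => hf _ _ b h.choose_spec e⟩
    · simp only [dif_neg h]
      exact ⟨fun e => by simp at e, fun e => (h ⟨a, e⟩).elim⟩

theorem ofPartialInjective_apply (f : α → Option β) (hf) (a : α) :
    ofPartialInjective f hf a = f a := rfl

theorem symm_eq_some {f : α ≃. β} {a : α} {b : β} : f.symm b = some a ↔ f a = some b :=
  f.eq_some_iff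

theorem symm_eq_none {f : α ≃. β} {b : β} : f.symm b = none ↔ ∀ a, f a ≠ some b := by
  rw [Option.eq_none_iff_forall_ne_some]
  simp only [ne_eq, symm_eq_some]

theorem eq_of_apply {f : α ≃. β} {a a' : α} {b : β} (h : f a = some b) (h' : f a' = some b) :
    a = a' :=
  f.inj h h'

instance [Finite α] [Finite β] : Finite (α ≃. β) :=
  Finite.of_injective (fun f : α ≃. β => (f : α → Option β)) fun _ _ h => PEquiv.ext (congrFun h)

theorem ncard_le_of_mapsTo [Finite β] {f : α ≃. β} {A : Set α} {B : Set β}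
    (hf : ∀ a ∈ A, ∃ b ∈ B, f a = some b) : A.ncard ≤ B.ncard := by
  choose F hF hfF using hf
  rw [← Nat.card_coe_set_eq, ← Nat.card_coe_set_eq]
  refine Nat.card_le_card_of_injective (fun a : A => (⟨F a a.2, hF a a.2⟩ : B)) fun a a' h => ?_
  have h' : F a a.2 = F a' a'.2 := congrArg Subtype.val h
  exact Subtype.ext (eq_of_apply (hfF a a.2) (h' ▸ hfF a' a'.2))

/-- If `f` maps `A` into `B`, and `B` has no more elements than `A`, then `f` maps `A` onto `B`. -/
theorem exists_of_ncard_le [Finite β] {f : α ≃. β} {A : Set α} {B : Set β}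
    (hf : ∀ a ∈ A, ∃ b ∈ B, f a = some b) (h : B.ncard ≤ A.ncard) :
    ∀ b ∈ B, ∃ a ∈ A, f a = some b := by
  choose F hF hfF using hf
  intro b hb
  obtain ⟨a, ha, e⟩ := Set.surj_on_of_inj_on_of_ncard_le F hF
    (fun a a' ha ha' e => eq_of_apply (hfF a ha) (e ▸ hfF a' ha')) h (Set.toFinite _) b hb
  exact ⟨a, ha, e ▸ hfF a ha⟩

theorem ncard_le_of_surjOn [Finite α] {f : α ≃. β} {A : Set α} {B : Set β}
    (hf : ∀ b ∈ B, ∃ a ∈ A, f a = some b) : B.ncard ≤ A.ncard :=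
  ncard_le_of_mapsTo (f := f.symm) fun b hb =>
    let ⟨a, ha, e⟩ := hf b hb
    ⟨a, ha, symm_eq_some.2 e⟩

/-- If `f` maps `A` into `B`, and every element of `B` has its `g`-partner in `A`, then `f` maps
`A` onto `B`. -/
theorem exists_of_mapsTo [Finite α] [Finite β] {f g : α ≃. β} {A : Set α} {B : Set β}
    (hf : ∀ a ∈ A, ∃ b ∈ B, f a = some b) (hg : ∀ b ∈ B, ∃ a ∈ A, g a = some b) :
    ∀ b ∈ B, ∃ a ∈ A, f a = some b :=
  exists_of_ncard_le hf (ncard_le_of_surjOn hg)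

end PEquiv

theorem exists_max_with_default {α : Type*} [Finite α] (c : ℝ) (g : α → ℝ) :
    ∃ x, c ≤ x ∧ (∀ a, g a ≤ x) ∧ (x = c ∨ ∃ a, x = g a) := by
  obtain ⟨x, hx, hmax⟩ := Set.exists_max_image (insert c (Set.range g)) id (Set.toFinite _)
    ⟨c, Set.mem_insert _ _⟩
  refine ⟨x, hmax c (Set.mem_insert _ _), fun a => hmax _ (Set.mem_insert_of_mem _ ⟨a, rfl⟩), ?_⟩
  rcases hx with h | ⟨a, h⟩
  · exact Or.inl h
  · exact Or.inr ⟨a, h.symm⟩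

/-! ### Decomposition of two equilibria; joins and meets. -/

section Core

variable {I J : Type*} {U : UtilityProfile I J} {r r' : I → ℝ} {a a' : J → ℝ}
  {W W' : EqPoint I J} {μ μ' : I ≃. J}

/-- `W` is a competitive equilibrium with supporting matching `μ` when the buyers have the outside
options `r` and the goods the reservation prices `a`. -/
structure SupportsAbove (U : UtilityProfile I J) (r : I → ℝ) (a : J → ℝ) (W : EqPoint I J)
    (μ : I ≃. J) : Prop where
  tight : ∀ i j, μ i = some j → W.u i = U i j (W.p j)
  stable : ∀ i j, U i j (W.p j) ≤ W.u i
  unmatched_left : ∀ i, μ i = none → W.u i = r i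
  unmatched_right : ∀ j, μ.symm j = none → W.p j = a j
  le_u : ∀ i, r i ≤ W.u i
  le_p : ∀ j, a j ≤ W.p j

/-- The equilibria above the reservation values `r` and `a`. -/
def equilibriaAbove (U : UtilityProfile I J) (r : I → ℝ) (a : J → ℝ) : Set (EqPoint I J) :=
  {W | ∃ μ, SupportsAbove U r a W μ}

namespace SupportsAbove

theorem dual (h : SupportsAbove U r a W μ) : SupportsAbove U.dual a r W.swap μ.symm where
  tight j i e := U.inv_eq_iff.2 (h.tight i j (PEquiv.symm_eq_some.1 e))
  stable j i := U.inv_le_iff.2 (h.stable i j)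
  unmatched_left := h.unmatched_right
  unmatched_right := h.unmatched_left
  le_u := h.le_p
  le_p := h.le_u

theorem of_dual (h : SupportsAbove U.dual a r W.swap μ.symm) : SupportsAbove U r a W μ := by
  have := h.dual
  rwa [U.dual_dual] at this

theorem exists_left (h : SupportsAbove U r a W μ) {i : I} (hi : r i < W.u i) :
    ∃ j, μ i = some j := by
  by_contra hn
  push Not at hn
  exact hi.ne' (h.unmatched_left i (Option.eq_none_iff_forall_ne_some.2 hn))

theorem exists_right (h : SupportsAbove U r a W μ) {j : J} (hj : a j < W.p j) :
    ∃ i, μ i = some j := by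
  obtain ⟨i, hi⟩ := h.dual.exists_left hj
  exact ⟨i, PEquiv.symm_eq_some.1 hi⟩

theorem price_lt (h' : SupportsAbove U r' a' W' μ') {i : I} {j : J} (hi : W'.u i < W.u i)
    (ht : W.u i = U i j (W.p j)) : W.p j < W'.p j := by
  rw [← U.lt_iff (i := i) (j := j), ← ht]
  exact (h'.stable i j).trans_lt hi

theorem payoff_lt (h : SupportsAbove U r a W μ) {i : I} {j : J} (hj : W.p j < W'.p j)
    (ht : W'.u i = U i j (W'.p j)) : W'.u i < W.u i := by
  rw [ht]
  exact (U.lt_iff.2 hj).trans_le (h.stable i j)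

/-- A buyer with `W'.u i < W.u i` is above the reservation value in `W`, hence matched by `μ`; since
`W'` is stable at this pair, the partner must be dearer in `W'`. The reservation values may differ
between the two equilibria, which allows comparing markets with and without an agent. -/
theorem forall_exists_left (h : SupportsAbove U r a W μ) (h' : SupportsAbove U r' a' W' μ')
    (hr : r ≤ r') : ∀ i ∈ {i | W'.u i < W.u i}, ∃ j ∈ {j | W.p j < W'.p j}, μ i = some j := by
  intro i hi
  obtain ⟨j, hj⟩ := h.exists_left (((hr i).trans (h'.le_u i)).trans_lt hi)
  exact ⟨j, h'.price_lt hi (h.tight i j hj), hj⟩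

theorem forall_exists_right' (h : SupportsAbove U r a W μ) (h' : SupportsAbove U r' a' W' μ')
    (ha : a' ≤ a) : ∀ j ∈ {j | W.p j < W'.p j}, ∃ i ∈ {i | W'.u i < W.u i}, μ' i = some j := by
  intro j hj
  obtain ⟨i, hi⟩ := h'.exists_right (((ha j).trans (h.le_p j)).trans_lt hj)
  exact ⟨i, h.payoff_lt hj (h'.tight i j hi), hi⟩

theorem p_le_iff (h : SupportsAbove U r a W μ) (h' : SupportsAbove U r a W' μ') :
    W.p ≤ W'.p ↔ W'.u ≤ W.u := by
  constructor
  · intro hp i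
    by_contra! hi
    obtain ⟨j, hj, -⟩ := h'.forall_exists_left h le_rfl i hi
    exact (hp j).not_gt hj
  · intro hu j
    by_contra! hj
    obtain ⟨i, hi, -⟩ := h'.forall_exists_right' h le_rfl j hj
    exact (hu i).not_gt hi

theorem eq_of_p_eq (h : SupportsAbove U r a W μ) (h' : SupportsAbove U r a W' μ')
    (e : W.p = W'.p) : W = W' :=
  EqPoint.ext (le_antisymm ((h'.p_le_iff h).1 e.ge) ((h.p_le_iff h').1 e.le)) e

/-- Use the first matching on `A × B`, the second one elsewhere. -/
theorem splice {W₁ W₂ : EqPoint I J} {μ₁ μ₂ : I ≃. J} {A : Set I} {B : Set J}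
    [DecidablePred (· ∈ A)]
    (h₁ : ∀ i ∈ A, ∃ j ∈ B, μ₁ i = some j ∧ W₁.u i = U i j (W₁.p j))
    (h₁' : ∀ j ∈ B, ∃ i ∈ A, μ₁ i = some j)
    (h₂ : SupportsAbove U r a W₂ μ₂)
    (hA : ∀ i ∈ A, ∃ j ∈ B, μ₂ i = some j) (hB : ∀ j ∈ B, ∃ i ∈ A, μ₂ i = some j)
    (hu₁ : ∀ i ∈ A, W.u i = W₁.u i) (hu₂ : ∀ i ∉ A, W.u i = W₂.u i)
    (hp₁ : ∀ j ∈ B, W.p j = W₁.p j) (hp₂ : ∀ j ∉ B, W.p j = W₂.p j)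
    (hstable : ∀ i j, U i j (W.p j) ≤ W.u i) (hr : ∀ i, r i ≤ W.u i) (ha : ∀ j, a j ≤ W.p j) :
    ∃ ν : I ≃. J, (∀ i, ν i = if i ∈ A then μ₁ i else μ₂ i) ∧ SupportsAbove U r a W ν := by
  -- The combined matching never crosses between the blocks `A × B` and `Aᶜ × Bᶜ`; injectivity then
  -- reduces to each block.
  have key : ∀ i j, (if i ∈ A then μ₁ i else μ₂ i) = some j → (i ∈ A ↔ j ∈ B) := by
    intro i j e
    split_ifs at e with hi
    · obtain ⟨j', hj', e', -⟩ := h₁ i hi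
      obtain rfl : j' = j := Option.some_inj.1 (e'.symm.trans e)
      exact iff_of_true hi hj'
    · refine iff_of_false hi fun hj => hi ?_
      obtain ⟨i', hi', e'⟩ := hB j hj
      exact PEquiv.eq_of_apply e e' ▸ hi'
  have hinj : ∀ i i' j, (if i ∈ A then μ₁ i else μ₂ i) = some j →
      (if i' ∈ A then μ₁ i' else μ₂ i') = some j → i = i' := by
    intro i i' j e e'
    have hii := (key i j e).trans (key i' j e').symm
    by_cases hi : i ∈ A
    · rw [if_pos hi] at e
      rw [if_pos (hii.1 hi)] at e'
      exact PEquiv.eq_of_apply e e'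
    · rw [if_neg hi] at e
      rw [if_neg (hii.not.1 hi)] at e'
      exact PEquiv.eq_of_apply e e'
  refine ⟨PEquiv.ofPartialInjective _ hinj, fun _ => rfl, ⟨?_, hstable, ?_, ?_, hr, ha⟩⟩
  · intro i j e
    rw [PEquiv.ofPartialInjective_apply] at e
    have hij := key i j e
    by_cases hi : i ∈ A
    · rw [if_pos hi] at e
      obtain ⟨j', hj', e', ht⟩ := h₁ i hi
      obtain rfl : j' = j := Option.some_inj.1 (e'.symm.trans e)
      rw [hu₁ i hi, hp₁ _ hj', ht]
    · rw [if_neg hi] at e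
      rw [hu₂ i hi, hp₂ j (hij.not.1 hi), h₂.tight i j e]
  · intro i e
    rw [PEquiv.ofPartialInjective_apply] at e
    by_cases hi : i ∈ A
    · obtain ⟨j', -, e', -⟩ := h₁ i hi
      simp [if_pos hi, e'] at e
    · rw [if_neg hi] at e
      rw [hu₂ i hi, h₂.unmatched_left i e]
  · intro j e
    rw [PEquiv.symm_eq_none] at e
    simp only [PEquiv.ofPartialInjective_apply] at e
    by_cases hj : j ∈ B
    · obtain ⟨i, hi, e'⟩ := h₁' j hj
      exact (e i (by rw [if_pos hi, e'])).elim
    · rw [hp₂ j hj]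
      refine h₂.unmatched_right j (PEquiv.symm_eq_none.2 fun i e' => ?_)
      refine e i ?_
      rw [if_neg, e']
      intro hi
      obtain ⟨j', hj', e''⟩ := hA i hi
      obtain rfl : j' = j := Option.some_inj.1 (e''.symm.trans e')
      exact hj hj'

variable [Finite I] [Finite J]

/-- `μ` injects the better-off buyers into the dearer goods, and `μ'` provides an injection the
other way. By finiteness both are bijections, so no member of either set is unmatched in either
equilibrium. -/
theorem forall_exists_right (h : SupportsAbove U r a W μ) (h' : SupportsAbove U r' a' W' μ')
    (hr : r ≤ r') (ha : a' ≤ a) :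
    ∀ j ∈ {j | W.p j < W'.p j}, ∃ i ∈ {i | W'.u i < W.u i}, μ i = some j :=
  PEquiv.exists_of_mapsTo (h.forall_exists_left h' hr) (h.forall_exists_right' h' ha)

theorem forall_exists_left' (h : SupportsAbove U r a W μ) (h' : SupportsAbove U r' a' W' μ')
    (hr : r ≤ r') (ha : a' ≤ a) :
    ∀ i ∈ {i | W'.u i < W.u i}, ∃ j ∈ {j | W.p j < W'.p j}, μ' i = some j := by
  have := PEquiv.exists_of_mapsTo (f := μ'.symm) (g := μ.symm) (A := {j | W.p j < W'.p j})
    (B := {i | W'.u i < W.u i})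
    (fun j hj => by simpa only [PEquiv.symm_eq_some] using h.forall_exists_right' h' ha j hj)
    (fun i hi => by simpa only [PEquiv.symm_eq_some] using h.forall_exists_left h' hr i hi)
  simpa only [PEquiv.symm_eq_some] using this

/-- The join of two equilibria, with a supporting matching. -/
theorem sup (h : SupportsAbove U r a W μ) (h' : SupportsAbove U r a W' μ') :
    ∃ ν : I ≃. J, (∀ i, ν i = if W.u i < W'.u i then μ i else μ' i) ∧
      SupportsAbove U r a ⟨W.u ⊓ W'.u, W.p ⊔ W'.p⟩ ν := by
  refine splice (A := {i | W.u i < W'.u i}) (B := {j | W'.p j < W.p j}) (W₁ := W) (W₂ := W')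
    (fun i hi => ?_) (h'.forall_exists_right' h le_rfl) h'
    (h'.forall_exists_left h le_rfl) (h'.forall_exists_right h le_rfl le_rfl)
    (fun i hi => inf_eq_left.2 (le_of_lt hi)) (fun i hi => inf_eq_right.2 (le_of_not_gt hi))
    (fun j hj => sup_eq_left.2 (le_of_lt hj)) (fun j hj => sup_eq_right.2 (le_of_not_gt hj))
    (fun i j => le_inf ?_ ?_) (fun i => le_inf (h.le_u i) (h'.le_u i))
    (fun j => (h.le_p j).trans le_sup_left)
  · obtain ⟨j, hj, e⟩ := h'.forall_exists_left' h le_rfl le_rfl i hi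
    exact ⟨j, hj, e, h.tight i j e⟩
  · exact (U.le_iff.2 le_sup_left).trans (h.stable i j)
  · exact (U.le_iff.2 le_sup_right).trans (h'.stable i j)

/-- The meet of two equilibria, with a supporting matching. -/
theorem inf (h : SupportsAbove U r a W μ) (h' : SupportsAbove U r a W' μ') :
    ∃ ν : I ≃. J, (∀ i, ν i = if W.u i ≥ W'.u i then μ i else μ' i) ∧
      SupportsAbove U r a ⟨W.u ⊔ W'.u, W.p ⊓ W'.p⟩ ν := by
  have hstable : ∀ i j, U i j (W.p j ⊓ W'.p j) ≤ W.u i ⊔ W'.u i := fun i j => by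
    rcases le_total (W.p j) (W'.p j) with e | e
    · exact (U.le_iff.2 (le_inf le_rfl e)).trans ((h.stable i j).trans le_sup_left)
    · exact (U.le_iff.2 (le_inf e le_rfl)).trans ((h'.stable i j).trans le_sup_right)
  obtain ⟨ν, hν, hs⟩ := splice (W := ⟨W.u ⊔ W'.u, W.p ⊓ W'.p⟩) (A := {i | W.u i < W'.u i})
    (B := {j | W'.p j < W.p j}) (W₁ := W') (W₂ := W) (μ₁ := μ')
    (fun i hi => let ⟨j, hj, e⟩ := h'.forall_exists_left h le_rfl i hi; ⟨j, hj, e, h'.tight i j e⟩)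
    (h'.forall_exists_right h le_rfl le_rfl) h
    (h'.forall_exists_left' h le_rfl le_rfl) (h'.forall_exists_right' h le_rfl)
    (fun i hi => sup_eq_right.2 (le_of_lt hi)) (fun i hi => sup_eq_left.2 (le_of_not_gt hi))
    (fun j hj => inf_eq_right.2 (le_of_lt hj)) (fun j hj => inf_eq_left.2 (le_of_not_gt hj))
    hstable (fun i => (h.le_u i).trans le_sup_left) (fun j => le_inf (h.le_p j) (h'.le_p j))
  refine ⟨ν, fun i => ?_, hs⟩
  rw [hν i]
  by_cases hi : W.u i < W'.u i
  · rw [if_pos (show i ∈ {i | W.u i < W'.u i} from hi), if_neg (not_le.2 hi)]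
  · rw [if_neg (show i ∉ {i | W.u i < W'.u i} from hi), if_pos (not_lt.1 hi)]

end SupportsAbove

end Core

/-! ### Compactness, extreme equilibria and raising prices. -/

section Core

open Filter Topology

variable {I J : Type*} {U : UtilityProfile I J} {r r' : I → ℝ} {a a' : J → ℝ}
  {W W' : EqPoint I J} {μ μ' : I ≃. J}

theorem isClosed_supportsAbove (U : UtilityProfile I J) (r : I → ℝ) (μ : I ≃. J) :
    IsClosed {x : (J → ℝ) × (I → ℝ) × (J → ℝ) | SupportsAbove U r x.1 ⟨x.2.1, x.2.2⟩ μ} := by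
  have hU : ∀ i j, Continuous fun x : (J → ℝ) × (I → ℝ) × (J → ℝ) => U i j (x.2.2 j) :=
    fun i j => (U.isUtility i j).continuous.comp (by fun_prop)
  have e : {x : (J → ℝ) × (I → ℝ) × (J → ℝ) | SupportsAbove U r x.1 ⟨x.2.1, x.2.2⟩ μ} =
      {x | (∀ i j, μ i = some j → x.2.1 i = U i j (x.2.2 j)) ∧
        (∀ i j, U i j (x.2.2 j) ≤ x.2.1 i) ∧ (∀ i, μ i = none → x.2.1 i = r i) ∧
        (∀ j, μ.symm j = none → x.2.2 j = x.1 j) ∧ (∀ i, r i ≤ x.2.1 i) ∧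
        ∀ j, x.1 j ≤ x.2.2 j} :=
    Set.ext fun x => ⟨fun h => ⟨h.tight, h.stable, h.unmatched_left, h.unmatched_right, h.le_u,
      h.le_p⟩, fun ⟨h₁, h₂, h₃, h₄, h₅, h₆⟩ => ⟨h₁, h₂, h₃, h₄, h₅, h₆⟩⟩
  rw [e]
  simp only [Set.ofPred_and, Set.ofPred_forall]
  refine (isClosed_iInter fun i => isClosed_iInter fun j => isClosed_iInter fun _ => ?_).inter
    ((isClosed_iInter fun i => isClosed_iInter fun j => ?_).inter
    ((isClosed_iInter fun i => isClosed_iInter fun _ => ?_).inter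
    ((isClosed_iInter fun j => isClosed_iInter fun _ => ?_).inter
    ((isClosed_iInter fun i => ?_).inter (isClosed_iInter fun j => ?_)))))
  · exact isClosed_eq (by fun_prop) (hU i j)
  · exact isClosed_le (hU i j) (by fun_prop)
  · exact isClosed_eq (by fun_prop) (by fun_prop)
  · exact isClosed_eq (by fun_prop) (by fun_prop)
  · exact isClosed_le (by fun_prop) (by fun_prop)
  · exact isClosed_le (by fun_prop) (by fun_prop)

variable [Finite I] [Finite J]

/-- The reservation prices vary too, so that limits can be taken as they are perturbed. Payoffs are
bounded because every agent gets either the reservation value or the utility from a partner who gets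
at least the reservation value. -/
theorem isCompact_supportsAbove (U : UtilityProfile I J) (r : I → ℝ) (a₀ a₁ : J → ℝ)
    (μ : I ≃. J) :
    IsCompact {x : (J → ℝ) × (I → ℝ) × (J → ℝ) |
      x.1 ∈ Set.Icc a₀ a₁ ∧ SupportsAbove U r x.1 ⟨x.2.1, x.2.2⟩ μ} := by
  choose b hb hb' _ using fun i => exists_max_with_default (r i) fun j => U i j (a₀ j)
  choose c hc hc' _ using fun j => exists_max_with_default (a₁ j) fun i => U.inv i j (r i)
  refine (isCompact_Icc (a := (a₀, r, a₀)) (b := (a₁, b, c))).of_isClosed_subset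
    ((isClosed_Icc.preimage continuous_fst).inter (isClosed_supportsAbove U r μ)) ?_
  rintro ⟨a, u, p⟩ ⟨ha, h⟩
  refine ⟨⟨ha.1, h.le_u, ha.1.trans h.le_p⟩, ⟨ha.2, fun i => ?_, fun j => ?_⟩⟩
  · rcases e : μ i with _ | j
    · exact (h.unmatched_left i e).trans_le (hb i)
    · exact ((h.tight i j e).trans_le (U.le_iff.2 ((ha.1 j).trans (h.le_p j)))).trans (hb' i j)
  · rcases e : μ.symm j with _ | i
    · exact (h.unmatched_right j e).trans_le ((ha.2 j).trans (hc j))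
    · exact (h.dual.tight j i e).trans_le
        ((U.dual.le_iff.2 (h.le_u i)).trans (hc' j i))

/-- Among the equilibria with a closed property that is stable under joins there is a highest
one. -/
theorem exists_highest_of_closed (P : EqPoint I J → Prop) (hne : ∃ W ∈ equilibriaAbove U r a, P W)
    (hcl : IsClosed {x : (I → ℝ) × (J → ℝ) | P ⟨x.1, x.2⟩})
    (hsup : ∀ W W', P W → P W' → P ⟨W.u ⊓ W'.u, W.p ⊔ W'.p⟩) :
    ∃ W, IsHighestIn {W | W ∈ equilibriaAbove U r a ∧ P W} W := by
  have := Fintype.ofFinite J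
  have hK : IsCompact ((⋃ μ : I ≃. J, Prod.snd '' {x : (J → ℝ) × (I → ℝ) × (J → ℝ) |
      x.1 ∈ Set.Icc a a ∧ SupportsAbove U r x.1 ⟨x.2.1, x.2.2⟩ μ}) ∩
      {x : (I → ℝ) × (J → ℝ) | P ⟨x.1, x.2⟩}) :=
    (isCompact_iUnion fun μ =>
      (isCompact_supportsAbove U r a a μ).image continuous_snd).inter_right hcl
  obtain ⟨W₀, ⟨μ₀, h₀⟩, hP₀⟩ := hne
  obtain ⟨x, ⟨hx, hPx⟩, hmax⟩ := hK.exists_isMaxOn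
    ⟨(W₀.u, W₀.p), Set.mem_iUnion.2 ⟨μ₀, (a, W₀.u, W₀.p), ⟨⟨le_rfl, le_rfl⟩, h₀⟩, rfl⟩, hP₀⟩
    (f := fun x => ∑ j, x.2 j) (by fun_prop)
  obtain ⟨μ, ⟨a', x⟩, ⟨ha', h⟩, rfl⟩ := Set.mem_iUnion.1 hx
  obtain rfl : a' = a := le_antisymm ha'.2 ha'.1
  refine ⟨⟨x.1, x.2⟩, ⟨⟨μ, h⟩, hPx⟩, ?_⟩
  rintro W' ⟨⟨μ', h'⟩, hP'⟩
  obtain ⟨ν, -, hν⟩ := h.sup h'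
  -- A maximizer of the sum of prices dominates every `W'`, since the join with `W'` cannot have a
  -- larger sum.
  have hle : ∑ j, (x.2 j ⊔ W'.p j) ≤ ∑ j, x.2 j :=
    hmax (a := (x.1 ⊓ W'.u, x.2 ⊔ W'.p))
      ⟨Set.mem_iUnion.2 ⟨ν, (a', _), ⟨⟨le_rfl, le_rfl⟩, hν⟩, rfl⟩, hsup _ _ hPx hP'⟩
  have heq := (Finset.sum_eq_sum_iff_of_le fun j _ => le_sup_left).1
    (le_antisymm (Finset.sum_le_sum fun j _ => le_sup_left) hle)
  exact fun j => sup_eq_left.1 (heq j (Finset.mem_univ j)).symm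

theorem exists_highest (hne : (equilibriaAbove U r a).Nonempty) :
    ∃ W, IsHighestIn (equilibriaAbove U r a) W := by
  obtain ⟨W, ⟨hW, -⟩, hmax⟩ := exists_highest_of_closed (U := U) (r := r) (a := a) (fun _ => True)
    (hne.imp fun W h => ⟨h, trivial⟩) (by simp) (fun _ _ _ _ => trivial)
  exact ⟨W, hW, fun W' h' => hmax W' ⟨h', trivial⟩⟩

/-- If the goods in `T` are matched to buyers above their outside options, all of whose tight edges
lead into `T`, then the prices in `T` can be raised. -/
theorem SupportsAbove.exists_higher (h : SupportsAbove U r a W μ) {T : Set J} (hT : T.Nonempty)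
    (hS : ∀ j ∈ T, ∃ i, μ i = some j ∧ r i < W.u i ∧ ∀ b, W.u i = U i b (W.p b) → b ∈ T)
    (hex : ∀ r' a', (∀ i, (∃ j, r' i ≤ U i j (a' j)) → ∃ j, μ i = some j) →
      (equilibriaAbove U r' a').Nonempty) :
    ∃ W' ∈ equilibriaAbove U r a, ¬ W'.p ≤ W.p := by
  classical
  set S : Set I := {i | ∃ j ∈ T, μ i = some j}
  -- Buyers in `S` get a reservation value below `W.u i` but above what goods outside `T` offer; all
  -- others get a prohibitive one. Thus only pairs in `S × T` remain possible.
  have hr' : ∀ i, ∃ x, (i ∈ S → r i ≤ x ∧ x < W.u i ∧ ∀ b ∉ T, U i b (W.p b) < x) ∧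
      (i ∉ S → x = W.u i + 1) := by
    intro i
    by_cases hi : i ∈ S
    · obtain ⟨m, hm, hm', hmax⟩ := exists_max_with_default (r i)
        fun b : {b // b ∉ T} => U i b (W.p b)
      have hlt : m < W.u i := by
        obtain ⟨j, hj, e⟩ := hi
        obtain ⟨i', e', hri, htight⟩ := hS j hj
        obtain rfl := PEquiv.eq_of_apply e e'
        rcases hmax with rfl | ⟨⟨b, hb⟩, rfl⟩
        · exact hri
        · exact (h.stable i b).lt_of_ne fun e => hb (htight b e.symm)
      refine ⟨(m + W.u i) / 2, fun _ => ⟨by linarith, by linarith, fun b hb => ?_⟩,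
        fun hi' => (hi' hi).elim⟩
      have : U i b (W.p b) ≤ m := hm' ⟨b, hb⟩
      linarith
    · exact ⟨_, fun hi' => (hi hi').elim, fun _ => rfl⟩
  choose r' hr'S hr'N using hr'
  -- The reservation prices: the current prices, raised by `δ` on `T`.
  let α : ℝ → J → ℝ := fun δ j => W.p j + if j ∈ T then δ else 0
  have hα : ∀ δ, 0 ≤ δ → W.p ≤ α δ := fun δ hδ j => by
    simp only [α]; split_ifs <;> linarith
  have hαT : ∀ δ, ∀ j ∉ T, α δ j = W.p j := fun δ j hj => by simp [α, hj]
  have hmem : ∀ {δ W' μ'}, 0 ≤ δ → SupportsAbove U r' (α δ) W' μ' → ∀ i j, μ' i = some j →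
      i ∈ S ∧ j ∈ T := by
    intro δ W' μ' hδ h' i j e
    have hle : r' i ≤ U i j (W.p j) := ((h'.le_u i).trans_eq (h'.tight i j e)).trans
      (U.le_iff.2 ((hα δ hδ j).trans (h'.le_p j)))
    have hi : i ∈ S := by
      by_contra hi
      have := h.stable i j
      rw [hr'N i hi] at hle
      linarith
    refine ⟨hi, ?_⟩
    by_contra hj
    exact hle.not_gt ((hr'S i hi).2.2 j hj)
  have h₀ : ∃ μ₀, SupportsAbove U r' (α 0) ⟨fun i => if i ∈ S then W.u i else W.u i + 1, W.p⟩
      μ₀ := by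
    refine ⟨PEquiv.ofPartialInjective (fun i => if i ∈ S then μ i else none) ?_,
      ⟨?_, ?_, ?_, ?_, ?_, ?_⟩⟩
    · intro i i' j e e'
      split_ifs at e e'
      exact PEquiv.eq_of_apply e e'
    · intro i j e
      rw [PEquiv.ofPartialInjective_apply] at e
      split_ifs at e with hi
      simp only [if_pos hi, h.tight i j e]
    · intro i j
      have := h.stable i j
      dsimp only
      split_ifs <;> linarith
    · intro i e
      rw [PEquiv.ofPartialInjective_apply] at e
      split_ifs at e with hi
      · obtain ⟨j, -, e'⟩ := hi
        simp [e] at e'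
      · simp only [if_neg hi, hr'N i hi]
    · intro j _
      simp [α]
    · intro i
      dsimp only
      split_ifs with hi
      · exact (hr'S i hi).2.1.le
      · exact (hr'N i hi).le
    · intro j
      simp [α]
  obtain ⟨μ₀, h₀⟩ := h₀
  -- At `δ = 0` the equilibrium `h₀` gives all of `S` more than `r'`, so by decomposition every
  -- equilibrium matches all of `S`. The reservation prices admitting an equilibrium with an
  -- unmatched member of `S` form a closed set within the box, so small `δ > 0` also avoid it.
  obtain ⟨δ, hδ, hgood⟩ : ∃ δ, 0 < δ ∧ ∀ W' μ', SupportsAbove U r' (α δ) W' μ' →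
      ∀ i ∈ S, μ' i ≠ none := by
    have hK : IsClosed (⋃ μ' ∈ {μ' : I ≃. J | ∃ i ∈ S, μ' i = none},
        Prod.fst '' {x : (J → ℝ) × (I → ℝ) × (J → ℝ) |
          x.1 ∈ Set.Icc (α 0) (α 1) ∧ SupportsAbove U r' x.1 ⟨x.2.1, x.2.2⟩ μ'}) :=
      (Set.toFinite _).isClosed_biUnion fun μ' _ =>
        ((isCompact_supportsAbove U r' (α 0) (α 1) μ').image continuous_fst).isClosed
    have hmono : ∀ {δ δ'}, δ ≤ δ' → α δ ≤ α δ' := fun hδ j => by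
      simp only [α]; split_ifs <;> linarith
    have hα0 : Continuous α := by
      refine continuous_pi fun j => ?_
      by_cases hj : j ∈ T <;> simp only [α, hj, if_true, if_false] <;> fun_prop
    have hnot : α 0 ∉ ⋃ μ' ∈ {μ' : I ≃. J | ∃ i ∈ S, μ' i = none},
        Prod.fst '' {x : (J → ℝ) × (I → ℝ) × (J → ℝ) |
          x.1 ∈ Set.Icc (α 0) (α 1) ∧ SupportsAbove U r' x.1 ⟨x.2.1, x.2.2⟩ μ'} := by
      intro hmem
      simp only [Set.mem_iUnion] at hmem
      obtain ⟨μ', ⟨i, hi, e⟩, ⟨_, u, p⟩, ⟨-, h'⟩, rfl⟩ := hmem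
      have hlt : u i < if i ∈ S then W.u i else W.u i + 1 := by
        rw [if_pos hi]
        exact (h'.unmatched_left i e).trans_lt (hr'S i hi).2.1
      obtain ⟨j, -, e'⟩ := h₀.forall_exists_left' h' le_rfl le_rfl i hlt
      simp [e] at e'
    have hev : ∀ᶠ δ in 𝓝[>] (0 : ℝ), α δ ∉ ⋃ μ' ∈ {μ' : I ≃. J | ∃ i ∈ S, μ' i = none},
        Prod.fst '' {x : (J → ℝ) × (I → ℝ) × (J → ℝ) |
          x.1 ∈ Set.Icc (α 0) (α 1) ∧ SupportsAbove U r' x.1 ⟨x.2.1, x.2.2⟩ μ'} :=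
      (hα0.continuousAt.eventually (hK.isOpen_compl.mem_nhds hnot)).filter_mono
        nhdsWithin_le_nhds
    obtain ⟨δ, hδ, hδ'⟩ := (hev.and (Ioc_mem_nhdsGT (zero_lt_one' ℝ))).exists
    refine ⟨δ, hδ'.1, fun W' μ' h' i hi e => hδ ?_⟩
    simp only [Set.mem_iUnion]
    exact ⟨μ', ⟨i, hi, e⟩, (α δ, W'.u, W'.p), ⟨⟨hmono hδ'.1.le, hmono hδ'.2⟩, h'⟩, rfl⟩
  obtain ⟨W₁, μ₁, h₁⟩ : (equilibriaAbove U r' (α δ)).Nonempty := by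
    refine hex r' (α δ) fun i ⟨j, hij⟩ => ?_
    by_cases hi : i ∈ S
    · obtain ⟨j, -, e⟩ := hi
      exact ⟨j, e⟩
    · have h1 : U i j (α δ j) ≤ U i j (W.p j) := U.le_iff.2 (hα δ hδ.le j)
      have h2 := h.stable i j
      rw [hr'N i hi] at hij
      linarith
  have hST : ∀ i ∈ S, ∃ j ∈ T, μ₁ i = some j := fun i hi => by
    obtain ⟨j, e⟩ := Option.ne_none_iff_exists'.1 (hgood W₁ μ₁ h₁ i hi)
    exact ⟨j, (hmem hδ.le h₁ i j e).2, e⟩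
  have hTS : ∀ j ∈ T, ∃ i ∈ S, μ i = some j := fun j hj =>
    let ⟨i, e, _⟩ := hS j hj
    ⟨i, ⟨j, hj, e⟩, e⟩
  have hle : W.p ≤ W₁.p := (hα δ hδ.le).trans h₁.le_p
  -- All of `S` is matched into `T` and `|T| ≤ |S|`, so `μ₁` matches `S` onto `T` and can replace
  -- `μ` there. Goods outside `T` are unmatched in `μ₁` and keep their old prices.
  obtain ⟨ν, -, hν⟩ := SupportsAbove.splice
    (W := ⟨fun i => if i ∈ S then W₁.u i else W.u i, W₁.p⟩) (W₁ := W₁) (W₂ := W)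
    (A := S) (B := T)
    (fun i hi => let ⟨j, hj, e⟩ := hST i hi; ⟨j, hj, e, h₁.tight i j e⟩)
    (PEquiv.exists_of_ncard_le hST (PEquiv.ncard_le_of_surjOn hTS)) h (fun i hi => hi) hTS
    (fun i hi => if_pos hi) (fun i hi => if_neg hi) (fun j _ => rfl)
    (fun j hj => (h₁.unmatched_right j (PEquiv.symm_eq_none.2 fun i e =>
      hj (hmem hδ.le h₁ i j e).2)).trans (hαT δ j hj))
    (fun i j => by
      dsimp only
      split_ifs
      · exact h₁.stable i j
      · exact (U.le_iff.2 (hle j)).trans (h.stable i j))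
    (fun i => by
      dsimp only
      split_ifs with hi
      · exact (hr'S i hi).1.trans (h₁.le_u i)
      · exact h.le_u i)
    (fun j => (h.le_p j).trans (hle j))
  refine ⟨_, ⟨ν, hν⟩, fun hcon => ?_⟩
  obtain ⟨j, hj⟩ := hT
  have h1 : W.p j + δ ≤ W₁.p j := by
    have := h₁.le_p j
    simpa [α, hj] using this
  have h2 : W₁.p j ≤ W.p j := hcon j
  linarith

end Core

/-! ### Critical paths, augmentation and existence. -/

section Core

variable {I J : Type*} {U : UtilityProfile I J} {r r' : I → ℝ} {a a' : J → ℝ}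
  {W W' : EqPoint I J} {μ μ' : I ≃. J}

/-- Some tight alternating path, of length `0` or with a matching edge first, leads from `j` to an
unmatched good or to a buyer who gets no more than the outside option. -/
def CriticalPath (U : UtilityProfile I J) (r : I → ℝ) (W : EqPoint I J) (μ : I ≃. J) (j : J) :
    Prop :=
  ∃ k, Relation.ReflTransGen (fun x y => ∃ i, μ.symm x = some i ∧ W.u i = U i y (W.p y)) j k ∧
    (μ.symm k = none ∨ ∃ i, μ.symm k = some i ∧ W.u i = r i)

/-- A path that ends outside `j` either avoids leaving from `j`, or has a final section that starts
with a step from `j` and does not leave from `j` again. -/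
theorem Relation.ReflTransGen.avoid {α : Type*} {R : α → α → Prop} {j c k : α}
    (h : Relation.ReflTransGen R c k) :
    Relation.ReflTransGen (fun x y => x ≠ j ∧ R x y) c k ∨
      ∃ b, R j b ∧ Relation.ReflTransGen (fun x y => x ≠ j ∧ R x y) b k := by
  induction h using Relation.ReflTransGen.head_induction_on with
  | refl => exact Or.inl .refl
  | @head c d hcd _ ih =>
    rcases ih with ih | ih
    · by_cases hc : c = j
      · exact Or.inr ⟨d, hc ▸ hcd, ih⟩
      · exact Or.inl (.head ⟨hc, hcd⟩ ih)
    · exact Or.inr ih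

namespace SupportsAbove

/-- Match the unmatched buyer `i` to `j`, along a tight edge. -/
theorem rematch [DecidableEq I] [DecidableEq J] {i : I} {j : J}
    (h : SupportsAbove U (Function.update r i (W.u i)) a W μ) (hμ : μ i = none)
    (ht : W.u i = U i j (W.p j)) :
    ∃ ν : I ≃. J, (∀ k, ν k = if k = i then some j else if μ k = some j then none else μ k) ∧
      ∀ r', (∀ k, r' k ≤ W.u k) → (∀ k, μ k = some j → W.u k = r' k) →
        (∀ k, k ≠ i → μ k = none → r' k = r k) → SupportsAbove U r' a W ν := by
  let f : I → Option J := fun k => if k = i then some j else if μ k = some j then none else μ k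
  have hf : ∀ k b, f k = some b ↔ k = i ∧ b = j ∨ k ≠ i ∧ b ≠ j ∧ μ k = some b := by
    intro k b
    by_cases hk : k = i
    · simp [f, hk, eq_comm]
    · by_cases hkj : μ k = some j
      · simp only [f, if_neg hk, hkj, if_true, Option.some_inj]
        simp [hk, eq_comm]
      · simp only [f, if_neg hk, if_neg hkj]
        refine ⟨fun e => Or.inr ⟨hk, fun hb => hkj (hb ▸ e), e⟩, ?_⟩
        rintro (⟨h1, -⟩ | ⟨-, -, e⟩)
        exacts [(hk h1).elim, e]
  refine ⟨PEquiv.ofPartialInjective f ?_, fun _ => rfl, fun r' hr' hj hn =>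
    ⟨?_, h.stable, ?_, ?_, hr', h.le_p⟩⟩
  · intro k k' b e e'
    rw [hf] at e e'
    rcases e with ⟨rfl, rfl⟩ | ⟨-, hb, e⟩ <;> rcases e' with ⟨rfl, h'⟩ | ⟨-, hb', e'⟩
    exacts [rfl, (hb' rfl).elim, (hb h').elim, PEquiv.eq_of_apply e e']
  · intro k b e
    rcases (hf k b).1 e with ⟨rfl, rfl⟩ | ⟨-, -, e⟩
    exacts [ht, h.tight k b e]
  · intro k e
    change f k = none at e
    have hk : k ≠ i := fun hk => by simp [f, hk] at e
    by_cases hkj : μ k = some j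
    · exact hj k hkj
    · simp only [f, if_neg hk, if_neg hkj] at e
      rw [hn k hk e, h.unmatched_left k e, Function.update_of_ne hk]
  · intro b e
    rw [PEquiv.symm_eq_none] at e
    have e' : ∀ k, ¬ f k = some b := e
    simp only [hf] at e'
    refine h.unmatched_right b (PEquiv.symm_eq_none.2 fun k hk => e' k (Or.inr ⟨?_, ?_, hk⟩))
    · rintro rfl
      simp [hμ] at hk
    · exact fun hb => e' i (Or.inl ⟨rfl, hb⟩)

/-- The only defect is that buyer `i` is unmatched at a payoff possibly above `r i`, which the
updated reservation value hides. Matching `i` to `j` passes the defect to the displaced partner of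
`j`, and so on along the path, until an unmatched good or a buyer content with the outside option is
met. `X` contains the goods from which the path may still leave and makes the recursion finite. -/
theorem exists_augment [DecidableEq I] [DecidableEq J] (X : Finset J) :
    ∀ (μ : I ≃. J) (i : I) (j k : J),
      SupportsAbove U (Function.update r i (W.u i)) a W μ → r i ≤ W.u i → μ i = none →
      W.u i = U i j (W.p j) →
      Relation.ReflTransGen
        (fun x y => x ∈ X ∧ ∃ l, μ.symm x = some l ∧ W.u l = U l y (W.p y)) j k →
      (μ.symm k = none ∨ ∃ l, μ.symm k = some l ∧ W.u l = r l) →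
      ∃ ν, SupportsAbove U r a W ν := by
  induction X using Finset.strongInduction with
  | H X ih =>
  intro μ i j k h hi hμ ht hpath hend
  obtain ⟨ν, hν, hsupp⟩ := h.rematch hμ ht
  have hr : ∀ k, r k ≤ W.u k := fun k => by
    by_cases hk : k = i
    · exact hk ▸ hi
    · have := h.le_u k
      rwa [Function.update_of_ne hk] at this
  by_cases hjk : k = j
  · subst hjk
    refine ⟨ν, hsupp r hr (fun l hl => ?_) fun _ _ _ => rfl⟩
    rcases hend with e | ⟨l', e, hl'⟩
    · exact (PEquiv.symm_eq_none.1 e l hl).elim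
    · rwa [PEquiv.eq_of_apply hl (PEquiv.symm_eq_some.1 e)]
  have hsymm : ∀ {x l}, x ≠ j → μ.symm x = some l → ν.symm x = some l := by
    intro x l hx e
    rw [PEquiv.symm_eq_some] at e ⊢
    rw [hν l, if_neg (by rintro rfl; simp [hμ] at e), if_neg, e]
    rw [e, Option.some_inj]
    exact hx
  -- After its last departure from `j` the path uses only matching edges that the rematching left
  -- intact.
  obtain ⟨b, ⟨hjX, l, hl, htl⟩, hb⟩ :
      ∃ b, (j ∈ X ∧ ∃ l, μ.symm j = some l ∧ W.u l = U l b (W.p b)) ∧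
        Relation.ReflTransGen (fun x y => x ≠ j ∧ x ∈ X ∧
          ∃ l, μ.symm x = some l ∧ W.u l = U l y (W.p y)) b k := by
    rcases hpath.avoid (j := j) with h' | h'
    · rcases h'.cases_head with e | ⟨c, ⟨hne, -⟩, -⟩
      exacts [(hjk e.symm).elim, (hne rfl).elim]
    · exact h'
  rw [PEquiv.symm_eq_some] at hl
  refine ih (X.erase j) (Finset.erase_ssubset hjX) ν l b k ?_ (hr l) ?_ htl
    (Relation.ReflTransGen.mono (fun x y ⟨hx, hxX, m, hm, hty⟩ =>
      ⟨Finset.mem_erase.2 ⟨hx, hxX⟩, m, hsymm hx hm, hty⟩) _ _ hb) ?_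
  · refine hsupp _ (fun x => ?_) (fun x hx => ?_) fun x _ hx => ?_
    · by_cases hxl : x = l
      · simp [hxl]
      · rw [Function.update_of_ne hxl]
        exact hr x
    · rw [PEquiv.eq_of_apply hx hl, Function.update_self]
    · rw [Function.update_of_ne]
      rintro rfl
      simp [hl] at hx
  · rw [hν l, if_neg (by rintro rfl; simp [hμ] at hl), if_pos hl]
  · rcases hend with e | ⟨m, e, hm⟩
    · left
      rw [PEquiv.symm_eq_none] at e ⊢
      intro x hx
      rw [hν x] at hx
      split_ifs at hx
      · exact hjk (Option.some_inj.1 hx).symm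
      · exact e x hx
    · exact Or.inr ⟨m, hsymm hjk e, hm⟩

/-- From an equilibrium without buyer `i` (whose outside option is prohibitive) and with critical
paths one obtains an equilibrium with buyer `i`, at the same prices. -/
theorem exists_insert [DecidableEq I] [Finite J] {i : I} {R : ℝ}
    (h : SupportsAbove U (Function.update r i R) a W μ) (hμ : μ i = none)
    (hcrit : ∀ j, CriticalPath U (Function.update r i R) W μ j) :
    ∃ W' ∈ equilibriaAbove U r a, W'.p = W.p := by
  classical
  have := Fintype.ofFinite J
  -- `x` is the best payoff of `i` at the prices `W.p`. If it comes from a good, `i` is inserted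
  -- along the critical path from that good; otherwise `i` stays unmatched.
  obtain ⟨x, hrx, hx, hx'⟩ := exists_max_with_default (r i) fun j => U i j (W.p j)
  have hne : ∀ {k}, k ≠ i → Function.update W.u i x k = W.u k := fun hk =>
    Function.update_of_ne hk _ _
  have h' : ∀ r', (∀ k ≠ i, r' k = r k) → r' i = x →
      SupportsAbove U r' a ⟨Function.update W.u i x, W.p⟩ μ := by
    intro r' hr' hr'i
    refine ⟨fun k j e => ?_, fun k j => ?_, fun k e => ?_, h.unmatched_right, fun k => ?_, h.le_p⟩
    · have hk : k ≠ i := by rintro rfl; simp [hμ] at e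
      simp only [hne hk]
      exact h.tight k j e
    · by_cases hk : k = i
      · subst hk
        simpa using hx j
      · simp only [hne hk]
        exact h.stable k j
    · by_cases hk : k = i
      · subst hk
        simp [hr'i]
      · simp only [hne hk]
        rw [h.unmatched_left k e, Function.update_of_ne hk, hr' k hk]
    · by_cases hk : k = i
      · subst hk
        simp [hr'i]
      · simp only [hne hk]
        have := h.le_u k
        rwa [Function.update_of_ne hk, ← hr' k hk] at this
  rcases hx' with e | ⟨j, e⟩
  · exact ⟨_, ⟨μ, h' r (fun _ _ => rfl) e.symm⟩, rfl⟩
  · obtain ⟨k, hk, hend⟩ := hcrit j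
    have hl : ∀ {b l}, μ.symm b = some l → l ≠ i := by
      intro b l e' hli
      have := hμ.symm.trans (hli ▸ PEquiv.symm_eq_some.1 e')
      simp at this
    have hk' : Relation.ReflTransGen (fun y z => y ∈ Finset.univ ∧
        ∃ l, μ.symm y = some l ∧ Function.update W.u i x l = U l z (W.p z)) j k :=
      Relation.ReflTransGen.mono (fun b c ⟨l, e, ht⟩ =>
        ⟨Finset.mem_univ _, l, e, (hne (hl e)).trans ht⟩) _ _ hk
    have hend' : μ.symm k = none ∨ ∃ l, μ.symm k = some l ∧ Function.update W.u i x l = r l :=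
      hend.imp id fun ⟨l, e, ht⟩ =>
        ⟨l, e, (hne (hl e)).trans (ht.trans (Function.update_of_ne (hl e) _ _))⟩
    exact ⟨⟨Function.update W.u i x, W.p⟩, exists_augment Finset.univ μ i j k
      (h' _ (fun k hk => Function.update_of_ne hk _ _) (by simp)) (by simpa using hrx) hμ
      (by simpa using e) hk' hend', rfl⟩

variable [Finite I] [Finite J]

/-- If no critical end is reachable from `j`, the reachable goods satisfy the conditions of
`exists_higher`. The existence hypothesis `hex` is restricted so that the lemma can be used within
the induction that proves existence. -/
theorem criticalPath_of_isHighest (h : SupportsAbove U r a W μ)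
    (hmax : ∀ W' ∈ equilibriaAbove U r a, W'.p ≤ W.p)
    (hex : ∀ r' a', (∀ i, (∃ j, r' i ≤ U i j (a' j)) → ∃ j, μ i = some j) →
      (equilibriaAbove U r' a').Nonempty) (j : J) : CriticalPath U r W μ j := by
  by_contra hj
  obtain ⟨W', hW', hlt⟩ := h.exists_higher (T := {b | Relation.ReflTransGen
    (fun x y => ∃ i, μ.symm x = some i ∧ W.u i = U i y (W.p y)) j b}) ⟨j, .refl⟩ (fun b hb => by
      rcases e : μ.symm b with _ | i
      · exact (hj ⟨b, hb, Or.inl e⟩).elim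
      · exact ⟨i, PEquiv.symm_eq_some.1 e, (h.le_u i).lt_of_ne fun hi =>
          hj ⟨b, hb, Or.inr ⟨i, e, hi.symm⟩⟩, fun c hc => hb.tail ⟨i, e, hc⟩⟩) hex
  exact hlt (hmax W' hW')

end SupportsAbove

theorem SupportsAbove.eq_none_of_lt (h : SupportsAbove U r a W μ) {i : I}
    (hi : ∀ j, U i j (a j) < r i) : μ i = none := by
  rw [Option.eq_none_iff_forall_ne_some]
  intro j e
  have h1 := h.tight i j e
  have h2 : U i j (W.p j) ≤ U i j (a j) := U.le_iff.2 (h.le_p j)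
  have h3 := h.le_u i
  have h4 := hi j
  linarith

variable [Finite I] [Finite J]

/-- Induction on the number of buyers with an acceptable good at the reservation prices. A
prohibitive outside option removes one of them; the smaller market has a highest equilibrium, which
has critical paths, so the buyer can be inserted. -/
theorem equilibriaAbove_nonempty (U : UtilityProfile I J) (r : I → ℝ) (a : J → ℝ) :
    (equilibriaAbove U r a).Nonempty := by
  classical
  induction hn : {i | ∃ j, r i ≤ U i j (a j)}.ncard using Nat.strong_induction_on
    generalizing r a with
  | _ n ih =>
  by_cases hA : ∃ i, ∃ j, r i ≤ U i j (a j)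
  · obtain ⟨i, hi⟩ := hA
    obtain ⟨R, -, hR, -⟩ := exists_max_with_default 0 fun j => U i j (a j)
    have hlt : ∀ j, U i j (a j) < Function.update r i (R + 1) i := fun j => by
      have : U i j (a j) ≤ R := hR j
      rw [Function.update_self]
      linarith
    have hex : ∀ r' a', (∀ k, (∃ j, r' k ≤ U k j (a' j)) →
        ∃ j, Function.update r i (R + 1) k ≤ U k j (a j)) → (equilibriaAbove U r' a').Nonempty := by
      intro r' a' hk
      refine ih _ ?_ r' a' rfl
      rw [← hn]
      refine Set.ncard_lt_ncard (Set.ssubset_iff_of_subset (fun k hk' => ?_) |>.2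
        ⟨i, hi, fun hi' => ?_⟩) (Set.toFinite _)
      · obtain ⟨j, hj⟩ := hk k hk'
        by_cases hki : k = i
        · exact hki ▸ hi
        · exact ⟨j, by rwa [Function.update_of_ne hki] at hj⟩
      · obtain ⟨j, hj⟩ := hk i hi'
        exact hj.not_gt (hlt j)
    obtain ⟨W, ⟨μ, h⟩, hmax⟩ := exists_highest (hex (Function.update r i (R + 1)) a fun _ => id)
    obtain ⟨W', hW', -⟩ := h.exists_insert (h.eq_none_of_lt hlt)
      -- Buyers matched by `μ` have an acceptable good in the market without `i`, so the induction
      -- hypothesis covers all markets needed here.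
      (h.criticalPath_of_isHighest hmax fun r' a' hk => hex r' a' fun k hk' => by
        obtain ⟨j, e⟩ := hk k hk'
        exact ⟨j, ((h.le_u k).trans_eq (h.tight k j e)).trans (U.le_iff.2 (h.le_p j))⟩)
    exact ⟨W', hW'⟩
  · push Not at hA
    exact ⟨⟨r, a⟩, ⊥, by simp, fun i j => (hA i j).le, fun _ _ => rfl, fun _ _ => rfl,
      fun _ => le_rfl, fun _ => le_rfl⟩

end Core

/-! ### Characterizations of extreme equilibria, comparison and blocking. -/

theorem mem_equilibriaAbove_dual {I J : Type*} {U : UtilityProfile I J} {r : I → ℝ} {a : J → ℝ}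
    {W : EqPoint I J} :
    W.swap ∈ equilibriaAbove U.dual a r ↔ W ∈ equilibriaAbove U r a :=
  ⟨fun ⟨μ, h⟩ => ⟨μ.symm, SupportsAbove.of_dual (by simpa using h)⟩, fun ⟨μ, h⟩ => ⟨μ.symm, h.dual⟩⟩

section Core

variable {I J : Type*} {U : UtilityProfile I J} {r r' : I → ℝ} {a a' : J → ℝ}
  {W W' : EqPoint I J} {μ μ' : I ≃. J}

theorem isLowestIn_iff_dual :
    IsLowestIn (equilibriaAbove U r a) W ↔ IsHighestIn (equilibriaAbove U.dual a r) W.swap := by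
  constructor
  · rintro ⟨⟨μ, h⟩, hmin⟩
    refine ⟨⟨μ.symm, h.dual⟩, fun W' hW' => ?_⟩
    obtain ⟨μ', h'⟩ := (mem_equilibriaAbove_dual (W := W'.swap)).1 hW'
    exact (h.p_le_iff h').1 (hmin W'.swap ⟨μ', h'⟩)
  · rintro ⟨hW, hmax⟩
    obtain ⟨μ, h⟩ := mem_equilibriaAbove_dual.1 hW
    refine ⟨⟨μ, h⟩, fun W' ⟨μ', h'⟩ => ?_⟩
    exact (h.p_le_iff h').2 (hmax W'.swap ⟨μ'.symm, h'.dual⟩)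

variable [Finite I] [Finite J]

theorem exists_lowest (U : UtilityProfile I J) (r : I → ℝ) (a : J → ℝ) :
    ∃ W, IsLowestIn (equilibriaAbove U r a) W := by
  obtain ⟨W, hW⟩ := exists_highest (equilibriaAbove_nonempty U.dual a r)
  exact ⟨W.swap, isLowestIn_iff_dual.2 hW⟩

theorem SupportsAbove.isHighestIn_iff_criticalPath (h : SupportsAbove U r a W μ) :
    IsHighestIn (equilibriaAbove U r a) W ↔ ∀ j, CriticalPath U r W μ j := by
  refine ⟨fun hW => h.criticalPath_of_isHighest hW.2 fun r' a' _ =>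
    equilibriaAbove_nonempty U r' a', fun hcrit => ⟨⟨μ, h⟩, ?_⟩⟩
  rintro W' ⟨μ', h'⟩ j
  by_contra! hj
  obtain ⟨k, hk, hend⟩ := hcrit j
  -- A price increase spreads along the path: the partner of a dearer good is worse off in `W'`, so
  -- every good tight for this buyer is dearer as well. The end of the path is then matched, to a
  -- buyer above the outside option.
  have hk' : W.p k < W'.p k := by
    clear hend
    induction hk with
    | refl => exact hj
    | tail _ hbc ih =>
      obtain ⟨i, e, ht⟩ := hbc
      obtain ⟨i', hi', e'⟩ := h.forall_exists_right h' le_rfl le_rfl _ ih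
      obtain rfl := PEquiv.eq_of_apply (PEquiv.symm_eq_some.1 e) e'
      exact h'.price_lt hi' ht
  obtain ⟨i, hi, e⟩ := h.forall_exists_right h' le_rfl le_rfl k hk'
  rcases hend with e' | ⟨i', e', hi'⟩
  · exact PEquiv.symm_eq_none.1 e' i e
  · obtain rfl := PEquiv.eq_of_apply e (PEquiv.symm_eq_some.1 e')
    exact ((h'.le_u i).trans_lt hi).ne' hi'

theorem SupportsAbove.isLowestIn_iff_criticalPath (h : SupportsAbove U r a W μ) :
    IsLowestIn (equilibriaAbove U r a) W ↔ ∀ i, CriticalPath U.dual a W.swap μ.symm i :=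
  isLowestIn_iff_dual.trans h.dual.isHighestIn_iff_criticalPath

/-- If `S` has at most `|S|` tight goods, `μ` matches `S` onto them, so paths from these goods never
leave them and meet no critical end. Conversely, the buyers worse off in a higher equilibrium have
all their tight goods among the dearer ones, which are no more numerous. -/
theorem isHighestIn_iff_ncard (hW : W ∈ equilibriaAbove U r a) :
    IsHighestIn (equilibriaAbove U r a) W ↔ ∀ S : Set I, S.Nonempty → (∀ i ∈ S, r i < W.u i) →
      S.ncard + 1 ≤ {j | ∃ i ∈ S, W.u i = U i j (W.p j)}.ncard := by
  obtain ⟨μ, h⟩ := hW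
  constructor
  · intro hW S hS hr
    by_contra! hlt
    have hmaps : ∀ i ∈ S, ∃ j ∈ {j | ∃ i ∈ S, W.u i = U i j (W.p j)}, μ i = some j := by
      intro i hi
      obtain ⟨j, e⟩ := h.exists_left (hr i hi)
      exact ⟨j, ⟨i, hi, h.tight i j e⟩, e⟩
    have honto := PEquiv.exists_of_ncard_le hmaps (Nat.lt_succ_iff.1 hlt)
    obtain ⟨i, hi⟩ := hS
    obtain ⟨j, hj, -⟩ := hmaps i hi
    obtain ⟨k, hk, hend⟩ := h.isHighestIn_iff_criticalPath.1 hW j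
    have hk' : k ∈ {j | ∃ i ∈ S, W.u i = U i j (W.p j)} := by
      clear hend
      induction hk with
      | refl => exact hj
      | tail _ hbc ih =>
        obtain ⟨i, e, ht⟩ := hbc
        obtain ⟨i', hi', e'⟩ := honto _ ih
        obtain rfl := PEquiv.eq_of_apply (PEquiv.symm_eq_some.1 e) e'
        exact ⟨i, hi', ht⟩
    obtain ⟨i, hi, e⟩ := honto k hk'
    rcases hend with e' | ⟨i', e', hi'⟩
    · exact PEquiv.symm_eq_none.1 e' i e
    · obtain rfl := PEquiv.eq_of_apply e (PEquiv.symm_eq_some.1 e')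
      exact (hr i hi).ne' hi'
  · intro hcard
    refine ⟨⟨μ, h⟩, ?_⟩
    rintro W' ⟨μ', h'⟩ j
    by_contra! hj
    obtain ⟨i, hi, -⟩ := h.forall_exists_right' h' le_rfl j hj
    have h1 := hcard {i | W'.u i < W.u i} ⟨i, hi⟩ fun i hi => (h'.le_u i).trans_lt hi
    have h2 : {j | ∃ i ∈ {i | W'.u i < W.u i}, W.u i = U i j (W.p j)}.ncard ≤
        {j | W.p j < W'.p j}.ncard :=
      Set.ncard_le_ncard (fun j ⟨i, hi, ht⟩ => h'.price_lt hi ht) (Set.toFinite _)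
    have h3 := PEquiv.ncard_le_of_surjOn (h.forall_exists_right' h' le_rfl)
    omega

theorem isLowestIn_iff_ncard (hW : W ∈ equilibriaAbove U r a) :
    IsLowestIn (equilibriaAbove U r a) W ↔ ∀ T : Set J, T.Nonempty → (∀ j ∈ T, a j < W.p j) →
      T.ncard + 1 ≤ {i | ∃ j ∈ T, W.u i = U i j (W.p j)}.ncard := by
  rw [isLowestIn_iff_dual, isHighestIn_iff_ncard (mem_equilibriaAbove_dual.2 hW)]
  have : ∀ i j, W.swap.u j = U.dual j i (W.swap.p i) ↔ W.u i = U i j (W.p j) :=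
    fun i j => U.inv_eq_iff
  simp only [this]
  rfl

/-- Comparison of the lowest equilibrium with the highest equilibrium without buyer `i`. -/
theorem IsLowestIn.insert_buyer [DecidableEq I] (hW : IsLowestIn (equilibriaAbove U r a) W)
    {i : I} {R : ℝ} {H : EqPoint I J} (hR : ∀ j, U i j (a j) < R) (hrR : r i ≤ R)
    (hH : IsHighestIn (equilibriaAbove U (Function.update r i R) a) H) :
    W.p ≤ H.p ∧ (∀ j, U i j (H.p j) ≤ W.u i) ∧ (W.u i = r i ∨ ∃ j, W.u i = U i j (H.p j)) ∧
      ∀ μ, SupportsAbove U r a W μ → ∀ j, μ i = some j → W.p j = H.p j := by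
  obtain ⟨⟨ν, h⟩, hmax⟩ := hH
  obtain ⟨⟨μ, hμ⟩, hmin⟩ := hW
  have hνi : ν i = none := h.eq_none_of_lt (by simpa using hR)
  obtain ⟨V, ⟨ρ, hV⟩, hVp⟩ := h.exists_insert hνi
    (h.isHighestIn_iff_criticalPath.1 ⟨⟨ν, h⟩, hmax⟩)
  have hWV := hmin V ⟨ρ, hV⟩
  have hp : W.p ≤ H.p := hVp ▸ hWV
  have heq : ∀ μ, SupportsAbove U r a W μ → ∀ j, μ i = some j → W.p j = H.p j := by
    intro μ hμ j e
    by_contra hne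
    have hr : r ≤ Function.update r i R := fun k => by
      by_cases hk : k = i
      · subst hk
        simpa using hrR
      · rw [Function.update_of_ne hk]
    -- If the partner of `i` were dearer in `H`, decomposition would make `i` matched in `H` too,
    -- contrary to `hνi`.
    obtain ⟨i', hi', e'⟩ := hμ.forall_exists_right h hr le_rfl j ((hp j).lt_of_ne hne)
    obtain rfl := PEquiv.eq_of_apply e e'
    obtain ⟨j', -, e''⟩ := hμ.forall_exists_left' h hr le_rfl i hi'
    simp [hνi] at e''
  refine ⟨hp, fun j => hVp ▸ (hV.stable i j).trans ((hμ.p_le_iff hV).1 hWV i), ?_, heq⟩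
  rcases e : μ i with _ | j
  · exact Or.inl (hμ.unmatched_left i e)
  · exact Or.inr ⟨j, by rw [← heq μ hμ j e]; exact hμ.tight i j e⟩

/-- If some buyers get more in a feasible allocation than in the lowest equilibrium, then the
allocation is blocked by one of the other buyers. -/
theorem IsLowestIn.exists_blocking (hW : IsLowestIn (equilibriaAbove U r a) W) {v : I → ℝ}
    {p : J → ℝ} (hp : a ≤ p) (hv : ∀ i j, μ i = some j → v i = U i j (p j))
    (hmatched : ∀ i, W.u i < v i → ∃ j, μ i = some j) (hne : ∃ i, W.u i < v i) :
    ∃ i j, v i ≤ W.u i ∧ v i < U i j (p j) := by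
  obtain ⟨ν, h⟩ := hW.1
  set A : Set I := {i | W.u i < v i}
  set B : Set J := {j | ∃ i ∈ A, μ i = some j}
  have hAB : ∀ i ∈ A, ∃ j ∈ B, μ i = some j := fun i hi =>
    let ⟨j, e⟩ := hmatched i hi
    ⟨j, ⟨i, hi, e⟩, e⟩
  have hlt : ∀ j ∈ B, p j < W.p j := by
    rintro j ⟨i, hi, e⟩
    rw [← U.lt_iff (i := i) (j := j), ← hv i j e]
    exact (h.stable i j).trans_lt hi
  obtain ⟨i₀, hi₀⟩ := hne
  obtain ⟨j₀, hj₀, -⟩ := hAB i₀ hi₀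
  -- The goods of the winners are cheaper at `p` than in `W`, so tightness applies: more buyers are
  -- tight to them than there are winners. Any such nonwinner would profit at the lower price.
  have hcard := (isLowestIn_iff_ncard hW.1).1 hW B ⟨j₀, hj₀⟩ fun j hj => (hp j).trans_lt (hlt j hj)
  have hle := PEquiv.ncard_le_of_mapsTo hAB
  obtain ⟨i, ⟨j, hj, ht⟩, hi⟩ := Set.exists_mem_notMem_of_ncard_lt_ncard
    (Nat.lt_of_le_of_lt hle (Nat.lt_of_succ_le hcard)) (Set.toFinite _)
  have hi' : v i ≤ W.u i := not_lt.1 hi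
  exact ⟨i, j, hi', hi'.trans_lt (ht ▸ U.lt_iff.2 (hlt j hj))⟩

/-- Infima of arbitrary sets: being a lower bound is a closed condition, preserved by joins and
satisfied by the lowest equilibrium. -/
theorem exists_highest_lowerBound (U : UtilityProfile I J) (r : I → ℝ) (a : J → ℝ)
    {s : Set (EqPoint I J)} (hs : s ⊆ equilibriaAbove U r a) :
    ∃ W, IsHighestIn {W | W ∈ equilibriaAbove U r a ∧ ∀ V ∈ s, W.p ≤ V.p} W := by
  obtain ⟨L, hL, hmin⟩ := exists_lowest U r a
  refine exists_highest_of_closed _ ⟨L, hL, fun V hV => hmin V (hs hV)⟩ ?_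
    fun V V' h h' X hX => sup_le (h X hX) (h' X hX)
  simp only [Set.ofPred_forall]
  exact isClosed_iInter fun V => isClosed_iInter fun _ => isClosed_le continuous_snd continuous_const

end Core

theorem AgentMarket.reduce_apply {I J : Type*} (M : AgentMarket I J) (i : I) (j : J) (y : ℝ) :
    M.reduce.u i j y = M.u i j (-M.q.inv i j y) := rfl

/-- Both sides parametrize the same payoff frontier of the pair, since `y = q (-u⁻¹ x)` iff `x = u
(-q⁻¹ y)`. -/
theorem AgentMarket.swap_reduce_u {I J : Type*} (M : AgentMarket I J) :
    M.swap.reduce.u = M.reduce.u.dual := by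
  have h : M.swap.reduce.u.util = M.reduce.u.dual.util := by
    funext j i x
    change M.q i j (-M.u.inv i j x) = M.reduce.u.inv i j x
    rw [M.reduce.u.inv_eq_iff, M.reduce_apply, M.q.inv_apply, neg_neg, M.u.apply_inv]
  cases hM : M.swap.reduce.u
  cases hM' : M.reduce.u.dual
  rw [hM, hM'] at h
  subst h
  rfl

/-! ### Translation to buyer/good markets. -/

namespace GoodsMarket

variable {I J : Type*} {M : GoodsMarket I J} {W : EqPoint I J} {μ : I ≃. J}

theorem supports_iff : M.Supports W μ ↔ SupportsAbove M.u 0 0 W μ := by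
  refine ⟨fun h => ⟨h.matched, fun i j => ?_, h.unmatched_buyer, h.unmatched_good,
    h.payoff_nonneg, h.price_nonneg⟩, fun h => ⟨h.tight, fun i j _ => h.stable i j,
    h.unmatched_left, h.unmatched_right, h.le_u, h.le_p⟩⟩
  by_cases e : μ i = some j
  · exact (h.matched i j e).ge
  · exact h.preferred i j e

theorem equilibria_eq : M.equilibria = equilibriaAbove M.u 0 0 :=
  Set.ext fun _ => exists_congr fun _ => supports_iff

theorem inducedPayoff_eq {p : J → ℝ} {i : I} {x : ℝ} (h0 : 0 ≤ x) (hx : ∀ j, M.u i j (p j) ≤ x)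
    (hx' : x = 0 ∨ ∃ j, x = M.u i j (p j)) : M.inducedPayoff p i = x := by
  refine IsGreatest.csSup_eq ⟨?_, ?_⟩
  · exact hx'.imp id fun ⟨j, e⟩ => ⟨j, e.symm⟩
  · rintro y (rfl | ⟨j, rfl⟩)
    exacts [h0, hx j]

theorem inducedPrice_eq {u : I → ℝ} {j : J} {x : ℝ} (h0 : 0 ≤ x) (hx : ∀ i, M.u.inv i j (u i) ≤ x)
    (hx' : x = 0 ∨ ∃ i, x = M.u.inv i j (u i)) : M.inducedPrice u j = x := by
  refine IsGreatest.csSup_eq ⟨?_, ?_⟩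
  · exact hx'.imp id fun ⟨i, e⟩ => ⟨i, e.symm⟩
  · rintro y (rfl | ⟨j, rfl⟩)
    exacts [h0, hx j]

theorem inducedPayoff_eq_of_mem (hW : W ∈ equilibriaAbove M.u 0 0) (i : I) :
    M.inducedPayoff W.p i = W.u i := by
  obtain ⟨μ, h⟩ := hW
  refine inducedPayoff_eq (h.le_u i) (h.stable i) ?_
  rcases e : μ i with _ | j
  · exact Or.inl (h.unmatched_left i e)
  · exact Or.inr ⟨j, h.tight i j e⟩

theorem inducedPrice_eq_of_mem (hW : W ∈ equilibriaAbove M.u 0 0) (j : J) :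
    M.inducedPrice W.u j = W.p j := by
  obtain ⟨μ, h⟩ := hW
  refine inducedPrice_eq (h.le_p j) (h.dual.stable j) ?_
  rcases e : μ.symm j with _ | i
  · exact Or.inl (h.unmatched_right j e)
  · exact Or.inr ⟨i, h.dual.tight j i e⟩

theorem demandOfBuyers_eq (hW : W ∈ equilibriaAbove M.u 0 0) (S : Set I) :
    M.demandOfBuyers S W.p = {j | ∃ i ∈ S, W.u i = M.u i j (W.p j)} := by
  ext j
  simp only [demandOfBuyers, inducedPayoff_eq_of_mem hW, Set.mem_ofPred_eq, eq_comm]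

theorem demandOfGoods_eq (hW : W ∈ equilibriaAbove M.u 0 0) (T : Set J) :
    M.demandOfGoods T W.u = {i | ∃ j ∈ T, W.u i = M.u i j (W.p j)} := by
  ext i
  simp only [demandOfGoods, inducedPrice_eq_of_mem hW, Set.mem_ofPred_eq]
  refine exists_congr fun j => and_congr_right fun _ => ?_
  rw [eq_comm, M.u.inv_eq_iff]

theorem criticalFromBuyer_iff {i : I} :
    M.CriticalFromBuyer W μ i ↔ CriticalPath M.u.dual 0 W.swap μ.symm i := by
  have : ∀ i j, W.swap.u j = M.u.dual j i (W.swap.p i) ↔ W.u i = M.u i j (W.p j) :=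
    fun i j => M.u.inv_eq_iff
  simp only [CriticalPath, this]
  rfl

end GoodsMarket

/-! ### Two-sided markets: reduction, removal of agents, strategyproofness, complete lattice. -/

namespace AgentMarket

variable {I J : Type*} {M : AgentMarket I J} {W : EqPoint I J} {o : Outcome I J}

theorem SupportedBy.transfer_eq (h : M.SupportedBy W o) {i : I} {j : J}
    (e : o.matching i = some j) : o.transfer i j = -M.q.inv i j (W.p j) := by
  rw [h.matched_right i j e, M.q.inv_apply, neg_neg]

theorem SupportedBy.reduce (h : M.SupportedBy W o) : SupportsAbove M.reduce.u 0 0 W o.matching := by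
  refine ⟨fun i j e => ?_, fun i j => ?_, h.unmatched_left, h.unmatched_right, h.nonneg_left,
    h.nonneg_right⟩
  · rw [h.matched_left i j e, h.transfer_eq e, M.reduce_apply]
  · rw [M.reduce_apply]
    by_cases e : o.matching i = some j
    · rw [h.matched_left i j e, h.transfer_eq e]
    -- For an unmatched pair the preference of `j` only gives `t ≤ -q⁻¹ (p j)`; as `u` is
    -- decreasing, this suffices.
    · refine le_trans ?_ (h.preferred_left i j e)
      rw [M.u.le_iff, le_neg, M.q.inv_le_iff]
      exact h.preferred_right i j e

theorem supportedBy_of_reduce {μ : I ≃. J} (h : SupportsAbove M.reduce.u 0 0 W μ) :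
    M.SupportedBy W ⟨μ, fun i j => -M.q.inv i j (W.p j)⟩ where
  matched_left := h.tight
  matched_right i j _ := by simp only [neg_neg, M.q.apply_inv]
  preferred_left i j _ := h.stable i j
  preferred_right i j _ := by simp only [neg_neg, M.q.apply_inv, ge_iff_le, le_refl]
  unmatched_left := h.unmatched_left
  unmatched_right := h.unmatched_right
  nonneg_left := h.le_u
  nonneg_right := h.le_p

theorem equilibria_eq (M : AgentMarket I J) : M.equilibria = equilibriaAbove M.reduce.u 0 0 :=
  Set.ext fun _ => ⟨fun ⟨o, h⟩ => ⟨o.matching, h.reduce⟩, fun ⟨_, h⟩ =>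
    ⟨_, supportedBy_of_reduce h⟩⟩

theorem isLowest_iff : M.IsLowest W ↔ IsLowestIn (equilibriaAbove M.reduce.u 0 0) W := by
  rw [IsLowest, M.equilibria_eq]

theorem isHighest_iff : M.IsHighest W ↔ IsHighestIn (equilibriaAbove M.reduce.u 0 0) W := by
  rw [IsHighest, M.equilibria_eq]

theorem swap_isHighest_iff : M.swap.IsHighest W.swap ↔ M.IsLowest W := by
  rw [isHighest_iff, isLowest_iff, isLowestIn_iff_dual, swap_reduce_u]

theorem swap_isLowest_iff : M.swap.IsLowest W.swap ↔ M.IsHighest W :=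
  (swap_isHighest_iff (M := M.swap) (W := W.swap)).symm

theorem isLowest_unique {W' : EqPoint I J} (h : M.IsLowest W) (h' : M.IsLowest W') : W = W' := by
  rw [isLowest_iff] at h h'
  obtain ⟨μ, hμ⟩ := h.1
  obtain ⟨μ', hμ'⟩ := h'.1
  exact hμ.eq_of_p_eq hμ' (le_antisymm (h.2 _ h'.1) (h'.2 _ h.1))

theorem isHighest_unique {W' : EqPoint I J} (h : M.IsHighest W) (h' : M.IsHighest W') :
    W = W' := by
  have := isLowest_unique (swap_isLowest_iff.2 h) (swap_isLowest_iff.2 h')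
  exact congrArg EqPoint.swap this

/-- The outcome with the roles of the two sides exchanged. -/
def _root_.Outcome.swap (o : Outcome I J) : Outcome J I :=
  ⟨o.matching.symm, fun j i => -o.transfer i j⟩

theorem SupportedBy.swap (h : M.SupportedBy W o) : M.swap.SupportedBy W.swap o.swap where
  matched_left j i e := h.matched_right i j (PEquiv.symm_eq_some.1 e)
  matched_right j i e := by
    change W.u i = M.u i j (- -o.transfer i j)
    rw [neg_neg]
    exact h.matched_left i j (PEquiv.symm_eq_some.1 e)
  preferred_left j i e := h.preferred_right i j (mt PEquiv.symm_eq_some.2 e)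
  preferred_right j i e := by
    change W.u i ≥ M.u i j (- -o.transfer i j)
    rw [neg_neg]
    exact h.preferred_left i j (mt PEquiv.symm_eq_some.2 e)
  unmatched_left := h.unmatched_right
  unmatched_right := h.unmatched_left
  nonneg_left := h.nonneg_right
  nonneg_right := h.nonneg_left

theorem SupportedBy.leftPayoff_eq (h : M.SupportedBy W o) (i : I) :
    leftPayoff M.u o i = W.u i := by
  rcases e : o.matching i with _ | j
  · simp [leftPayoff, e, h.unmatched_left i e]
  · simp [leftPayoff, e, h.matched_left i j e]

section RemoveLeft

variable [DecidableEq I] {i : I} {R : ℝ}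

/-- Give the additional buyer `i` the payoff `R`. -/
def _root_.EqPoint.insertLeft (V : EqPoint {k : I // k ≠ i} J) (R : ℝ) : EqPoint I J :=
  ⟨fun k => if h : k ≠ i then V.u ⟨k, h⟩ else R, V.p⟩

/-- Removing `i` amounts to giving `i` an outside option `R` that no good can match at any
nonnegative price. -/
theorem insertLeft_mem (hR : ∀ j, M.reduce.u i j 0 < R) {V : EqPoint {k : I // k ≠ i} J}
    (hV : V ∈ (M.removeLeft i).equilibria) :
    V.insertLeft R ∈ equilibriaAbove M.reduce.u (Function.update 0 i R) 0 := by
  rw [equilibria_eq] at hV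
  obtain ⟨μ, h⟩ := hV
  have hne : ∀ k (hk : k ≠ i), (V.insertLeft R).u k = V.u ⟨k, hk⟩ := fun k hk => dif_pos hk
  have hi : (V.insertLeft R).u i = R := dif_neg (not_not.2 rfl)
  refine ⟨PEquiv.ofPartialInjective (fun k => if h : k ≠ i then μ ⟨k, h⟩ else none) ?_,
    fun k j e => ?_, fun k j => ?_, fun k e => ?_, fun j e => ?_, fun k => ?_, h.le_p⟩
  · intro k k' j e e'
    split_ifs at e e'
    exact congrArg Subtype.val (PEquiv.eq_of_apply e e')
  · rw [PEquiv.ofPartialInjective_apply] at e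
    split_ifs at e with hk
    rw [hne k hk]
    exact h.tight _ j e
  · by_cases hk : k = i
    · subst hk
      rw [hi]
      exact (M.reduce.u.le_iff.2 (h.le_p j)).trans (hR j).le
    · rw [hne k hk]
      exact h.stable ⟨k, hk⟩ j
  · rw [PEquiv.ofPartialInjective_apply] at e
    by_cases hk : k = i
    · subst hk
      rw [hi, Function.update_self]
    · rw [dif_pos hk] at e
      rw [hne k hk, Function.update_of_ne hk]
      exact h.unmatched_left _ e
  · refine h.unmatched_right j (PEquiv.symm_eq_none.2 fun k hk => ?_)
    refine PEquiv.symm_eq_none.1 e k ?_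
    rw [PEquiv.ofPartialInjective_apply, dif_pos k.2, hk]
  · by_cases hk : k = i
    · subst hk
      rw [hi, Function.update_self]
    · rw [hne k hk, Function.update_of_ne hk]
      exact h.le_u ⟨k, hk⟩

theorem restrict_mem (hR : ∀ j, M.reduce.u i j 0 < R)
    (hW : W ∈ equilibriaAbove M.reduce.u (Function.update 0 i R) 0) :
    (⟨fun k => W.u k, W.p⟩ : EqPoint {k : I // k ≠ i} J) ∈ (M.removeLeft i).equilibria := by
  rw [equilibria_eq]
  obtain ⟨μ, h⟩ := hW
  have hμ : μ i = none := h.eq_none_of_lt fun j => by simpa using hR j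
  refine ⟨PEquiv.ofPartialInjective (fun k => μ k) fun k k' j e e' =>
    Subtype.ext (PEquiv.eq_of_apply e e'), fun k j e => h.tight k j e, fun k j => h.stable k j,
    fun k e => ?_, fun j e => ?_, fun k => ?_, h.le_p⟩
  · have := h.unmatched_left k e
    rwa [Function.update_of_ne k.2] at this
  · refine h.unmatched_right j (PEquiv.symm_eq_none.2 fun k hk => ?_)
    have hki : k ≠ i := by
      rintro rfl
      simp [hμ] at hk
    exact PEquiv.symm_eq_none.1 e ⟨k, hki⟩ hk
  · have := h.le_u k
    rwa [Function.update_of_ne k.2] at this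

theorem insertLeft_isHighest (hR : ∀ j, M.reduce.u i j 0 < R) {H : EqPoint {k : I // k ≠ i} J}
    (hH : (M.removeLeft i).IsHighest H) :
    IsHighestIn (equilibriaAbove M.reduce.u (Function.update 0 i R) 0) (H.insertLeft R) :=
  ⟨insertLeft_mem hR hH.1, fun _ hW' => hH.2 _ (restrict_mem hR hW')⟩

end RemoveLeft

variable [Finite I] [Finite J]

theorem IsLowest.removeLeft (hW : M.IsLowest W) {i : I} {H : EqPoint {k : I // k ≠ i} J}
    (hH : (M.removeLeft i).IsHighest H) :
    W.u i = M.reduce.inducedPayoff H.p i ∧ (∀ j, W.p j ≤ H.p j) ∧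
      ∀ o, M.SupportedBy W o → ∀ j, o.matching i = some j → W.p j = H.p j := by
  classical
  obtain ⟨R, h0, hR, -⟩ := exists_max_with_default 0 fun j => M.reduce.u i j 0
  have hR' : ∀ j, M.reduce.u i j 0 < R + 1 := fun j => (hR j).trans_lt (lt_add_one R)
  rw [isLowest_iff] at hW
  obtain ⟨hp, hu, hu', heq⟩ := hW.insert_buyer hR' (h0.trans (lt_add_one R).le)
    (insertLeft_isHighest hR' hH)
  obtain ⟨μ, h⟩ := hW.1
  exact ⟨(GoodsMarket.inducedPayoff_eq (h.le_u i) hu hu').symm, hp, fun o ho => heq _ ho.reduce⟩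

/-- `IsLowest.removeLeft` for the market with the sides exchanged. -/
theorem IsHighest.removeRight (hW : M.IsHighest W) {j : J} {L : EqPoint I {k : J // k ≠ j}}
    (hL : (M.removeRight j).IsLowest L) :
    W.p j = M.reduce.inducedPrice L.u j ∧ (∀ i, W.u i ≤ L.u i) ∧
      ∀ o, M.SupportedBy W o → ∀ i, o.matching i = some j → W.u i = L.u i := by
  obtain ⟨h1, h2, h3⟩ := (swap_isLowest_iff.2 hW).removeLeft (i := j) (H := L.swap)
    (swap_isHighest_iff (M := M.removeRight j).2 hL)
  refine ⟨?_, h2, fun o ho i e => h3 o.swap ho.swap i (PEquiv.symm_eq_some.2 e)⟩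
  rw [GoodsMarket.inducedPayoff, swap_reduce_u] at h1
  exact h1

theorem existsUnique_isLowest (M : AgentMarket I J) : ∃! W, M.IsLowest W := by
  obtain ⟨W, hW⟩ := exists_lowest M.reduce.u 0 0
  exact ⟨W, isLowest_iff.2 hW, fun W' h' => isLowest_unique h' (isLowest_iff.2 hW)⟩

theorem existsUnique_isHighest (M : AgentMarket I J) : ∃! W, M.IsHighest W := by
  obtain ⟨W, hW⟩ := exists_highest (equilibriaAbove_nonempty M.reduce.u 0 0)
  exact ⟨W, isHighest_iff.2 hW, fun W' h' => isHighest_unique h' (isHighest_iff.2 hW)⟩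

theorem groupStrategyproofLeft {q : UtilityProfile I J} {f : UtilityProfile I J → Outcome I J}
    (hf : SelectsLowest q f) : GroupStrategyproofLeft f := by
  intro u u' S hS hu hlt
  obtain ⟨W, hW, h⟩ := hf u
  -- Only the stability of the outcome under misreports matters, not that it is lowest.
  obtain ⟨W', -, h'⟩ := hf u'
  set v : I → ℝ := leftPayoff u (f u') with hv
  have hvS : ∀ i ∈ S, W.u i < v i := fun i hi => h.leftPayoff_eq i ▸ hlt i hi
  have hvN : ∀ i ∉ S, v i = W'.u i := fun i hi => by
    rw [← h'.leftPayoff_eq i, hv, leftPayoff, leftPayoff]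
    simp only [hu i hi]
  have hmatched : ∀ i, W.u i < v i → ∃ j, (f u').matching i = some j := by
    intro i hi
    by_contra! hn
    have : v i = 0 := by simp [hv, leftPayoff, Option.eq_none_iff_forall_ne_some.2 hn]
    exact (h.nonneg_left i).not_gt (this ▸ hi)
  have htight : ∀ i j, (f u').matching i = some j →
      v i = (AgentMarket.mk u q).reduce.u i j (W'.p j) := by
    intro i j e
    rw [reduce_apply, ← h'.transfer_eq e]
    simp [hv, leftPayoff, e]
  obtain ⟨i₀, hi₀⟩ := hS
  obtain ⟨i, j, hle, hblock⟩ := (isLowest_iff.1 hW).exists_blocking (p := W'.p) h'.nonneg_right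
    htight hmatched ⟨i₀, hvS i₀ hi₀⟩
  -- The blocking buyer does not gain, hence is outside the coalition and reports truthfully. This
  -- contradicts stability in the reported market.
  have hi : i ∉ S := fun hi => (hvS i hi).not_ge hle
  have hst := h'.reduce.stable i j
  rw [reduce_apply] at hst hblock
  rw [hvN i hi] at hblock
  simp only [hu i hi] at hst
  exact hst.not_gt hblock

/-- The same utility functions, with the indices exchanged. -/
def _root_.UtilityProfile.flip {I J : Type*} (U : UtilityProfile I J) : UtilityProfile J I :=
  ⟨fun j i => U i j, fun j i => U.isUtility i j⟩

theorem groupStrategyproofRight {u : UtilityProfile I J} {f : UtilityProfile I J → Outcome I J}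
    (hf : SelectsHighest u f) : GroupStrategyproofRight f := by
  have hf' : SelectsLowest u.flip fun q => (f q.flip).swap := fun q => by
    obtain ⟨W, hW, h⟩ := hf q.flip
    exact ⟨W.swap, swap_isLowest_iff.2 hW, h.swap⟩
  intro q q' S hS hq hlt
  exact groupStrategyproofLeft hf' q.flip q'.flip S hS (fun j hj i => hq j hj i) hlt

theorem exists_completeLattice (M : AgentMarket I J) :
    ∃ _ : CompleteLattice M.equilibria,
      ∀ W W' : M.equilibria,
        (W ≤ W' ↔ W.1.p ≤ W'.1.p) ∧
        (W ≤ W' ↔ W'.1.u ≤ W.1.u) ∧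
        (W ⊓ W').1.p = W.1.p ⊓ W'.1.p ∧
        (W ⊓ W').1.u = W.1.u ⊔ W'.1.u ∧
        (W ⊔ W').1.p = W.1.p ⊔ W'.1.p ∧
        (W ⊔ W').1.u = W.1.u ⊓ W'.1.u := by
  have hex : ∀ s : Set M.equilibria, ∃ W : M.equilibria,
      (∀ V ∈ s, W.1.p ≤ V.1.p) ∧ ∀ X : M.equilibria, (∀ V ∈ s, X.1.p ≤ V.1.p) →
        X.1.p ≤ W.1.p := by
    intro s
    obtain ⟨W, ⟨hW, hle⟩, hmax⟩ := exists_highest_lowerBound M.reduce.u 0 0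
      (s := Subtype.val '' s) (by rintro _ ⟨V, -, rfl⟩; exact M.equilibria_eq ▸ V.2)
    refine ⟨⟨W, M.equilibria_eq ▸ hW⟩, fun V hV => hle V ⟨V, hV, rfl⟩, fun X hX =>
      hmax X ⟨M.equilibria_eq ▸ X.2, ?_⟩⟩
    rintro _ ⟨V, hV, rfl⟩
    exact hX V hV
  choose g hg hg' using hex
  let _ : PartialOrder M.equilibria := PartialOrder.lift (fun W => W.1.p) fun W W' e => by
    obtain ⟨o, h⟩ := W.2
    obtain ⟨o', h'⟩ := W'.2
    exact Subtype.ext (h.reduce.eq_of_p_eq h'.reduce e)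
  let _ : InfSet M.equilibria := ⟨g⟩
  let L : CompleteLattice M.equilibria := completeLatticeOfInf _ fun s =>
    ⟨fun V hV => hg s V hV, fun X hX => hg' s X fun V hV => hX hV⟩
  refine ⟨L, fun W W' => ?_⟩
  obtain ⟨o, h⟩ := W.2
  obtain ⟨o', h'⟩ := W'.2
  obtain ⟨ν, -, hν⟩ := h.reduce.inf h'.reduce
  obtain ⟨ρ, -, hρ⟩ := h.reduce.sup h'.reduce
  let A : M.equilibria := ⟨_, _, supportedBy_of_reduce hν⟩
  let B : M.equilibria := ⟨_, _, supportedBy_of_reduce hρ⟩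
  -- The lattice built from infima has abstract binary operations; antisymmetry identifies them with
  -- the explicit equilibria.
  have hA : W ⊓ W' = A := le_antisymm
    (show (W ⊓ W').1.p ≤ W.1.p ⊓ W'.1.p from le_inf (inf_le_left (a := W)) (inf_le_right (a := W)))
    (le_inf (show W.1.p ⊓ W'.1.p ≤ W.1.p from inf_le_left)
      (show W.1.p ⊓ W'.1.p ≤ W'.1.p from inf_le_right))
  have hB : W ⊔ W' = B := le_antisymm
    (sup_le (show W.1.p ≤ W.1.p ⊔ W'.1.p from le_sup_left)
      (show W'.1.p ≤ W.1.p ⊔ W'.1.p from le_sup_right))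
    (show W.1.p ⊔ W'.1.p ≤ (W ⊔ W').1.p from sup_le (le_sup_left (a := W)) (le_sup_right (a := W)))
  refine ⟨Iff.rfl, h.reduce.p_le_iff h'.reduce, ?_, ?_, ?_, ?_⟩
  exacts [by rw [hA], by rw [hA], by rw [hB], by rw [hB]]

end AgentMarket

theorem mainTheorem5 {I J : Type*} [Finite I] [Finite J] (M : AgentMarket I J) :
    -- the two markets have the same equilibria, with the same supporting matchings, and the
    -- transfers between matched agents are determined by the payoffs
    (M.equilibria = M.reduce.equilibria ∧
      (∀ (W : EqPoint I J) (μ : I ≃. J),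
        M.reduce.Supports W μ ↔ ∃ t : I → J → ℝ, M.SupportedBy W ⟨μ, t⟩) ∧
      (∀ (W : EqPoint I J) (o : Outcome I J), M.SupportedBy W o →
        ∀ i j, o.matching i = some j → o.transfer i j = -M.q.inv i j (W.p j))) ∧
    -- the equilibria form a complete lattice (in particular there are some)
    (∃ _ : CompleteLattice M.equilibria,
      ∀ W W' : M.equilibria,
        (W ≤ W' ↔ W.1.p ≤ W'.1.p) ∧
        (W ≤ W' ↔ W'.1.u ≤ W.1.u) ∧
        (W ⊓ W').1.p = W.1.p ⊓ W'.1.p ∧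
        (W ⊓ W').1.u = W.1.u ⊔ W'.1.u ∧
        (W ⊔ W').1.p = W.1.p ⊔ W'.1.p ∧
        (W ⊔ W').1.u = W.1.u ⊓ W'.1.u ∧
        ∀ o o' : Outcome I J, M.SupportedBy W.1 o → M.SupportedBy W'.1 o' →
          (∃ oInf : Outcome I J, M.SupportedBy (W ⊓ W').1 oInf ∧
            ∀ i, oInf.matching i =
              if W.1.u i ≥ W'.1.u i then o.matching i else o'.matching i) ∧
          (∃ oSup : Outcome I J, M.SupportedBy (W ⊔ W').1 oSup ∧
            ∀ i, oSup.matching i =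
              if W.1.u i < W'.1.u i then o.matching i else o'.matching i)) ∧
    (∃! W, M.IsLowest W) ∧
    (∃! W, M.IsHighest W) ∧
    -- inductive characterization of the lowest and the highest equilibrium
    (∀ W, M.IsLowest W → ∀ (i : I) (H : EqPoint {k : I // k ≠ i} J),
      (M.removeLeft i).IsHighest H →
        W.u i = M.reduce.inducedPayoff H.p i ∧
        (∀ j, W.p j ≤ H.p j) ∧
        ∀ o, M.SupportedBy W o → ∀ j, o.matching i = some j → W.p j = H.p j) ∧
    (∀ W, M.IsHighest W → ∀ (j : J) (L : EqPoint I {k : J // k ≠ j}),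
      (M.removeRight j).IsLowest L →
        W.p j = M.reduce.inducedPrice L.u j ∧
        (∀ i, W.u i ≤ L.u i) ∧
        ∀ o, M.SupportedBy W o → ∀ i, o.matching i = some j → W.u i = L.u i) ∧
    -- tightness
    (∀ W ∈ M.equilibria,
      (M.IsLowest W ↔ ∀ T : Set J, T.Nonempty → (∀ j ∈ T, 0 < W.p j) →
        T.ncard + 1 ≤ (M.reduce.demandOfGoods T W.u).ncard) ∧
      (M.IsHighest W ↔ ∀ S : Set I, S.Nonempty → (∀ i ∈ S, 0 < W.u i) →
        S.ncard + 1 ≤ (M.reduce.demandOfBuyers S W.p).ncard)) ∧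
    -- critical alternating paths
    (∀ W o, M.SupportedBy W o →
      (M.IsHighest W ↔ ∀ j, M.reduce.CriticalFromGood W o.matching j) ∧
      (M.IsLowest W ↔ ∀ i, M.reduce.CriticalFromBuyer W o.matching i)) ∧
    -- group strategyproofness for each side, under its own lowest equilibrium
    (∀ f : UtilityProfile I J → Outcome I J,
      SelectsLowest M.q f → GroupStrategyproofLeft f) ∧
    (∀ f : UtilityProfile I J → Outcome I J,
      SelectsHighest M.u f → GroupStrategyproofRight f) ∧
    -- exchanging the two sides exchanges lowest and highest equilibria
    (∀ W : EqPoint I J,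
      (M.swap.IsLowest W.swap ↔ M.IsHighest W) ∧
      (M.swap.IsHighest W.swap ↔ M.IsLowest W)) := by
  refine ⟨⟨?_, fun W μ => ?_, fun W o h i j e => h.transfer_eq e⟩, ?_, M.existsUnique_isLowest,
    M.existsUnique_isHighest, fun W hW i H hH => AgentMarket.IsLowest.removeLeft hW hH,
    fun W hW j L hL => AgentMarket.IsHighest.removeRight hW hL, fun W hW => ?_,
    fun W o h => ⟨?_, ?_⟩, fun f => AgentMarket.groupStrategyproofLeft,
    fun f => AgentMarket.groupStrategyproofRight,
    fun W => ⟨AgentMarket.swap_isLowest_iff, AgentMarket.swap_isHighest_iff⟩⟩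
  · rw [M.equilibria_eq, GoodsMarket.equilibria_eq]
  · rw [GoodsMarket.supports_iff]
    exact ⟨fun h => ⟨_, AgentMarket.supportedBy_of_reduce h⟩, fun ⟨_, h⟩ => h.reduce⟩
  · obtain ⟨L, hL⟩ := M.exists_completeLattice
    refine ⟨L, fun W W' => ?_⟩
    obtain ⟨h1, h2, h3, h4, h5, h6⟩ := hL W W'
    refine ⟨h1, h2, h3, h4, h5, h6, fun o o' h h' => ⟨?_, ?_⟩⟩
    · obtain ⟨ν, hν, hs⟩ := h.reduce.inf h'.reduce
      rw [show (W ⊓ W').1 = ⟨W.1.u ⊔ W'.1.u, W.1.p ⊓ W'.1.p⟩ from EqPoint.ext h4 h3]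
      exact ⟨_, AgentMarket.supportedBy_of_reduce hs, hν⟩
    · obtain ⟨ν, hν, hs⟩ := h.reduce.sup h'.reduce
      rw [show (W ⊔ W').1 = ⟨W.1.u ⊓ W'.1.u, W.1.p ⊔ W'.1.p⟩ from EqPoint.ext h6 h5]
      exact ⟨_, AgentMarket.supportedBy_of_reduce hs, hν⟩
  · rw [M.equilibria_eq] at hW
    rw [AgentMarket.isLowest_iff, AgentMarket.isHighest_iff, isLowestIn_iff_ncard hW,
      isHighestIn_iff_ncard hW]
    simp only [GoodsMarket.demandOfGoods_eq hW, GoodsMarket.demandOfBuyers_eq hW]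
    exact ⟨Iff.rfl, Iff.rfl⟩
  · rw [AgentMarket.isHighest_iff]
    exact h.reduce.isHighestIn_iff_criticalPath
  · rw [AgentMarket.isLowest_iff, h.reduce.isLowestIn_iff_criticalPath]
    simp only [GoodsMarket.criticalFromBuyer_iff]
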